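/- Let $k\ge 2$ be an integer and let $\lambda>0$. For each $n$ let $u=u_n\in\{\pm1\}^n$ be a deterministic vector and let $W_n\sim\mathrm{GOE}(n)$, that is, $W_n\in\mathbb R^{n\times n}$ is a random symmetric matrix whose entries $(W_{n,ij})_{i\le j}$ are independent, with $W_{n,ii}\sim \mathsf N(0,2/n)$ and $W_{n,ij}\sim \mathsf N(0,1/n)$ for $i<j$. All the $W_n$ are defined on one common probability space, and nothing is assumed about their joint law for different $n$. Put $A_n=\frac{\lambda}{n}u_nu_n^{\mathsf T}+W_n$, and let $\mathrm{Cr}_{n,k}$ be the set of local maximizers of $$\sigma\mapsto \langle\sigma,A_n\sigma\rangle=\mathrm{Tr}(\sigma^{\mathsf T}A_n\sigma)$$ over the set of matrices $\sigma\in\mathbb R^{n\times k}$ all of whose rows have Euclidean norm $1$. Then, almost surely, $$\liminf_{n\to\infty}\ \inf_{\sigma\in \mathrm{Cr}_{n,k}}\ \frac{1}{n^2}\,\|\sigma^{\mathsf T}u_n\|_2^2\ \ge\ 1-\min\left(\frac{16}{\lambda},\ \frac1k+\frac4\lambda\right).$$ -/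

import Mathlib

open MeasureTheory ProbabilityTheory Filter Matrix

noncomputable section

/-- A random matrix `W`, defined on the probability space `(Ω, P)`, has the law `GOE(n)`: it is
(almost surely) symmetric, the entries on and above the diagonal are independent, diagonal entries
are `N(0, 2/n)` and entries above the diagonal are `N(0, 1/n)`. -/
structure IsGOE {Ω : Type*} [MeasurableSpace Ω] (P : Measure Ω) (n : ℕ)
    (W : Ω → Matrix (Fin n) (Fin n) ℝ) : Prop where
  symm : ∀ᵐ ω ∂P, (W ω).IsSymm
  indep : iIndepFun
    (fun (p : {p : Fin n × Fin n // p.1 ≤ p.2}) (ω : Ω) => W ω p.1.1 p.1.2) P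
  law_diag : ∀ i : Fin n, HasLaw (fun ω => W ω i i) (gaussianReal 0 (2 / n)) P
  law_upper : ∀ i j : Fin n, i < j → HasLaw (fun ω => W ω i j) (gaussianReal 0 (1 / n)) P

/-- The spiked matrix `A(l) = (l / n) u uᵀ + W`. -/
def spikedMatrix {n : ℕ} (l : ℝ) (u : Fin n → ℝ) (W : Matrix (Fin n) (Fin n) ℝ) :
    Matrix (Fin n) (Fin n) ℝ :=
  (l / n) • vecMulVec u u + W

/-- The feasible set of the rank-`k` problem: `n × k` matrices whose rows have Euclidean
norm one. -/
def rankManifold (n k : ℕ) : Set (Matrix (Fin n) (Fin k) ℝ) :=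
  {σ | ∀ i, ‖(WithLp.toLp 2 (σ i) : EuclideanSpace ℝ (Fin k))‖ = 1}

/-- The objective `⟨σ, A σ⟩ = Tr (σᵀ A σ)` of the rank-`k` problem. -/
def objective {n k : ℕ} (A : Matrix (Fin n) (Fin n) ℝ) (σ : Matrix (Fin n) (Fin k) ℝ) : ℝ :=
  trace (σᵀ * (A * σ))

/-- The set of local maximizers of the rank-`k` problem with data `A`: maximize `⟨σ, A σ⟩` over
`n × k` matrices with unit rows. -/
def localMaximizers {n : ℕ} (k : ℕ) (A : Matrix (Fin n) (Fin n) ℝ) :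
    Set (Matrix (Fin n) (Fin k) ℝ) :=
  {σ | σ ∈ rankManifold n k ∧ IsLocalMaxOn (objective A) (rankManifold n k) σ}

/-- The normalized squared correlation `‖σᵀ u‖₂² / n²` (Euclidean norm on `ℝᵏ`). -/
def correlation {n k : ℕ} (u : Fin n → ℝ) (σ : Matrix (Fin n) (Fin k) ℝ) : ℝ :=
  ‖(WithLp.toLp 2 (σᵀ *ᵥ u) : EuclideanSpace ℝ (Fin k))‖ ^ 2 / (n : ℝ) ^ 2

end

/-! Suppose the noise satisfies `|quadForm W x| ≤ K ‖x‖²`. At a local maximizer the rows of `A σ`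
are multiples `Λ i` of the rows of `σ`, and `objective A v ≤ ∑ Λ i ‖v i‖²` for tangent `v`; both
follow from stereographic curves on the product of spheres.

Testing the second condition with the spike times the tangent projections of the coordinate vectors,
and summing over these, gives correlation at least `1 - 1/k - 2K/l`
(`correlation_ge_of_localMaximizer`). For large `l` the first condition improves this: `W σ = Λ σ -
l u mᵀ` with `m = σᵀu/n` has squared Frobenius norm at most `K² n`, so most rows `u i • σ i` must
point along `m` (`sq_mul_one_sub_sqrt_correlation_le`). Antialigned rows are excluded because the
second condition forces `Λ i ≥ -K`.

It remains to see that almost surely, for every `κ > 0`, eventually `K = 2 + κ` works. Orthogonal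
invariance of the GOE allows one row to be removed at a time; each removal fails with exponentially
small probability (`goe_exceedance_le`), so the failure probabilities are summable. Borel–Cantelli
needs no assumption on the joint law. -/

/-! ### First- and second-order conditions on a product of spheres. -/

theorem mem_rankManifold_iff {n k : ℕ} {σ : Matrix (Fin n) (Fin k) ℝ} :
    σ ∈ rankManifold n k ↔ ∀ i, ∑ a, σ i a ^ 2 = 1 := by
  simp only [rankManifold, Set.mem_ofPred_eq]
  refine forall_congr' fun i => ?_
  rw [EuclideanSpace.norm_eq, Real.sqrt_eq_one]
  simp

theorem trace_transpose_mul {n k : ℕ} (x y : Matrix (Fin n) (Fin k) ℝ) :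
    trace (xᵀ * y) = ∑ i, ∑ a, x i a * y i a := by
  simp only [trace, diag, mul_apply, transpose_apply]
  exact Finset.sum_comm

theorem objective_add_smul {n k : ℕ} {A : Matrix (Fin n) (Fin n) ℝ} (hA : A.IsSymm)
    (σ y : Matrix (Fin n) (Fin k) ℝ) (t : ℝ) :
    objective A (σ + t • y) =
      objective A σ + t * (2 * trace (yᵀ * (A * σ)) + t * objective A y) := by
  have h : trace (σᵀ * (A * y)) = trace (yᵀ * (A * σ)) := by
    rw [← trace_transpose, transpose_mul, transpose_mul, transpose_transpose, hA.eq,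
      Matrix.mul_assoc]
  simp only [objective, transpose_add, transpose_smul, Matrix.mul_add, Matrix.add_mul, trace_add,
    Matrix.mul_smul, Matrix.smul_mul, trace_smul, smul_eq_mul, h]
  ring

/-- The direction in which the stereographic curve through `σ` with velocity `2 v` leaves `σ`:
the point `σ + t • curveDirection σ v t` has unit rows when `v` is tangent at `σ`. -/
noncomputable def curveDirection {n k : ℕ} (σ v : Matrix (Fin n) (Fin k) ℝ) (t : ℝ) :
    Matrix (Fin n) (Fin k) ℝ :=
  fun i a => (2 * v i a - 2 * t * (∑ b, v i b ^ 2) * σ i a) / (1 + t ^ 2 * ∑ b, v i b ^ 2)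

theorem one_add_sq_mul_sum_sq_pos {k : ℕ} (w : Fin k → ℝ) (t : ℝ) :
    0 < 1 + t ^ 2 * ∑ b, w b ^ 2 := by
  have : 0 ≤ ∑ b, w b ^ 2 := Finset.sum_nonneg fun b _ => sq_nonneg _
  positivity

theorem continuous_curveDirection {n k : ℕ} (σ v : Matrix (Fin n) (Fin k) ℝ) :
    Continuous (curveDirection σ v) := by
  refine continuous_pi fun i => continuous_pi fun a => ?_
  unfold curveDirection
  refine Continuous.div (by fun_prop) (by fun_prop) fun t => ?_
  exact (one_add_sq_mul_sum_sq_pos _ t).ne'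

theorem curveDirection_zero {n k : ℕ} (σ v : Matrix (Fin n) (Fin k) ℝ) :
    curveDirection σ v 0 = (2 : ℝ) • v := by
  ext i a
  simp [curveDirection]

theorem add_smul_curveDirection_mem {n k : ℕ} {σ v : Matrix (Fin n) (Fin k) ℝ}
    (hσ : σ ∈ rankManifold n k) (hv : ∀ i, ∑ a, σ i a * v i a = 0) (t : ℝ) :
    σ + t • curveDirection σ v t ∈ rankManifold n k := by
  rw [mem_rankManifold_iff] at hσ ⊢
  intro i
  have hq := one_add_sq_mul_sum_sq_pos (v i) t
  set q := ∑ b, v i b ^ 2 with hqdef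
  -- The row equals `((1 - t²q) σ i + 2t v i) / (1 + t²q)`, and `(1 - t²q)² + 4t²q = (1 + t²q)²`.
  have h : ∀ a, (σ + t • curveDirection σ v t) i a ^ 2 =
      ((1 - t ^ 2 * q) ^ 2 * σ i a ^ 2 + 4 * t ^ 2 * v i a ^ 2
        + 4 * t * (1 - t ^ 2 * q) * (σ i a * v i a)) / (1 + t ^ 2 * q) ^ 2 := by
    intro a
    simp only [Matrix.add_apply, Matrix.smul_apply, smul_eq_mul, curveDirection, ← hqdef]
    field_simp
    ring
  simp_rw [h]
  rw [← Finset.sum_div, Finset.sum_add_distrib, Finset.sum_add_distrib, ← Finset.mul_sum,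
    ← Finset.mul_sum, ← Finset.mul_sum, hσ i, hv i, ← hqdef, div_eq_one_iff_eq (by positivity)]
  ring

theorem sum_curveDirection_mul {n k : ℕ} {σ v : Matrix (Fin n) (Fin k) ℝ}
    (hσ : σ ∈ rankManifold n k) (hv : ∀ i, ∑ a, σ i a * v i a = 0) (t : ℝ) (i : Fin n) :
    ∑ a, curveDirection σ v t i a * σ i a =
      t * (-2 * (∑ b, v i b ^ 2) / (1 + t ^ 2 * ∑ b, v i b ^ 2)) := by
  rw [mem_rankManifold_iff] at hσ
  have h : ∀ a, curveDirection σ v t i a * σ i a =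
      (2 * (σ i a * v i a) - 2 * t * (∑ b, v i b ^ 2) * σ i a ^ 2)
        / (1 + t ^ 2 * ∑ b, v i b ^ 2) := by
    intro a
    simp only [curveDirection]
    ring
  simp_rw [h]
  rw [← Finset.sum_div, Finset.sum_sub_distrib, ← Finset.mul_sum, ← Finset.mul_sum, hσ i, hv i]
  ring

theorem eventually_curve_le {n k : ℕ} {A : Matrix (Fin n) (Fin n) ℝ}
    {σ v : Matrix (Fin n) (Fin k) ℝ} (hA : A.IsSymm) (hσ : σ ∈ localMaximizers k A)
    (hv : ∀ i, ∑ a, σ i a * v i a = 0) :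
    ∀ᶠ t : ℝ in nhds 0, t * (2 * trace ((curveDirection σ v t)ᵀ * (A * σ))
      + t * objective A (curveDirection σ v t)) ≤ 0 := by
  have hc : Continuous fun t : ℝ => σ + t • curveDirection σ v t :=
    continuous_const.add (continuous_id.smul (continuous_curveDirection σ v))
  have h0 : Tendsto (fun t : ℝ => σ + t • curveDirection σ v t) (nhds 0)
      (nhdsWithin σ (rankManifold n k)) := by
    refine tendsto_nhdsWithin_iff.2 ⟨?_, Eventually.of_forall
      (add_smul_curveDirection_mem hσ.1 hv)⟩
    simpa using hc.tendsto 0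
  filter_upwards [h0.eventually hσ.2] with t ht
  rw [objective_add_smul hA] at ht
  linarith

theorem continuous_objective {n k : ℕ} (A : Matrix (Fin n) (Fin n) ℝ) :
    Continuous (objective A : Matrix (Fin n) (Fin k) ℝ → ℝ) := by
  unfold objective
  fun_prop

/-- A continuous function that is nonpositive at all small positive arguments is nonpositive
at zero. -/
theorem nonpos_at_zero_of_eventually {g : ℝ → ℝ} (hg : Continuous g)
    (h : ∀ᶠ t : ℝ in nhdsWithin 0 (Set.Ioi 0), g t ≤ 0) : g 0 ≤ 0 :=
  le_of_tendsto (hg.continuousWithinAt (s := Set.Ioi 0)) h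

/-- First-order condition: each row of `A σ` is the multiple `Λ i` of the row of `σ`. -/
theorem localMaximizers_first_order {n k : ℕ} {A : Matrix (Fin n) (Fin n) ℝ}
    {σ : Matrix (Fin n) (Fin k) ℝ} (hA : A.IsSymm) (hσ : σ ∈ localMaximizers k A)
    (i : Fin n) (a : Fin k) :
    (A * σ) i a = (∑ b, σ i b * (A * σ) i b) * σ i a := by
  have hs := mem_rankManifold_iff.1 hσ.1
  set B := A * σ with hB
  -- The tangential part of `A σ`, half the Riemannian gradient; the derivative along it is a
  -- positive multiple of `‖v‖²`.
  set v : Matrix (Fin n) (Fin k) ℝ := fun i a => B i a - (∑ b, σ i b * B i b) * σ i a with hvdef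
  have hv : ∀ i, ∑ a, σ i a * v i a = 0 := by
    intro i
    have : ∀ a, σ i a * v i a = σ i a * B i a - (∑ b, σ i b * B i b) * σ i a ^ 2 := by
      intro a; simp only [hvdef]; ring
    simp_rw [this]
    rw [Finset.sum_sub_distrib, ← Finset.mul_sum, hs i, mul_one, sub_self]
  have hcont : Continuous fun t : ℝ => 2 * trace ((curveDirection σ v t)ᵀ * (A * σ))
      + t * objective A (curveDirection σ v t) := by
    have h1 := continuous_curveDirection σ v
    have h2 := (continuous_objective (k := k) A).comp h1
    refine Continuous.add ?_ (continuous_id.mul h2)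
    fun_prop
  have hle := nonpos_at_zero_of_eventually hcont (by
    filter_upwards [(eventually_curve_le hA hσ hv).filter_mono nhdsWithin_le_nhds,
      self_mem_nhdsWithin] with t ht ht0
    exact nonpos_of_mul_nonpos_right ht ht0)
  rw [zero_mul, add_zero, curveDirection_zero, trace_transpose_mul, ← hB] at hle
  have hsum : ∑ i, ∑ a, ((2 : ℝ) • v) i a * B i a = 2 * ∑ i, ∑ a, v i a ^ 2 := by
    rw [Finset.mul_sum]
    refine Finset.sum_congr rfl fun i _ => ?_
    have : ∀ a, ((2 : ℝ) • v) i a * B i a =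
        2 * v i a ^ 2 + 2 * (∑ b, σ i b * B i b) * (σ i a * v i a) := by
      intro a
      have hva : v i a = B i a - (∑ b, σ i b * B i b) * σ i a := rfl
      rw [Matrix.smul_apply, smul_eq_mul]
      linear_combination (2 * v i a) * -hva
    simp_rw [this]
    rw [Finset.sum_add_distrib, ← Finset.mul_sum, ← Finset.mul_sum, hv i, mul_zero, add_zero]
  rw [hsum] at hle
  have hnn : ∀ i, 0 ≤ ∑ a, v i a ^ 2 := fun i => Finset.sum_nonneg fun a _ => sq_nonneg _
  have hz : ∑ i, ∑ a, v i a ^ 2 = 0 :=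
    le_antisymm (by linarith) (Finset.sum_nonneg fun i _ => hnn i)
  have h1 := (Finset.sum_eq_zero_iff_of_nonneg fun i _ => hnn i).1 hz i (Finset.mem_univ _)
  have h2 := (Finset.sum_eq_zero_iff_of_nonneg fun a _ => sq_nonneg _).1 h1 a (Finset.mem_univ _)
  have h3 : v i a = 0 := by simpa using h2
  simp only [hvdef] at h3
  linarith

/-- Second-order condition along tangent directions. -/
theorem localMaximizers_second_order {n k : ℕ} {A : Matrix (Fin n) (Fin n) ℝ}
    {σ v : Matrix (Fin n) (Fin k) ℝ} (hA : A.IsSymm) (hσ : σ ∈ localMaximizers k A)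
    (hv : ∀ i, ∑ a, σ i a * v i a = 0) :
    objective A v ≤ ∑ i, (∑ b, σ i b * (A * σ) i b) * ∑ a, v i a ^ 2 := by
  set Λ : Fin n → ℝ := fun i => ∑ b, σ i b * (A * σ) i b with hΛ
  have hfirst : ∀ i a, (A * σ) i a = Λ i * σ i a := localMaximizers_first_order hA hσ
  -- The rows of `A σ` are normal, so they see only the normal part of the curve direction, which is
  -- of order `t`. The whole curve inequality is then divisible by `t²`.
  have htr : ∀ t, trace ((curveDirection σ v t)ᵀ * (A * σ)) =
      t * ∑ i, Λ i * (-2 * (∑ b, v i b ^ 2) / (1 + t ^ 2 * ∑ b, v i b ^ 2)) := by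
    intro t
    rw [trace_transpose_mul, Finset.mul_sum]
    refine Finset.sum_congr rfl fun i _ => ?_
    rw [← mul_assoc, mul_comm t, mul_assoc, ← sum_curveDirection_mul hσ.1 hv, Finset.mul_sum]
    refine Finset.sum_congr rfl fun a _ => ?_
    rw [hfirst]; ring
  have hcont : Continuous fun t : ℝ =>
      2 * (∑ i, Λ i * (-2 * (∑ b, v i b ^ 2) / (1 + t ^ 2 * ∑ b, v i b ^ 2)))
      + objective A (curveDirection σ v t) := by
    refine Continuous.add ?_ ((continuous_objective A).comp (continuous_curveDirection σ v))
    refine continuous_const.mul (continuous_finsetSum _ fun i _ => continuous_const.mul ?_)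
    exact Continuous.div (by fun_prop) (by fun_prop) fun t =>
      (one_add_sq_mul_sum_sq_pos _ t).ne'
  have hle := nonpos_at_zero_of_eventually hcont (by
    filter_upwards [(eventually_curve_le hA hσ hv).filter_mono nhdsWithin_le_nhds,
      self_mem_nhdsWithin] with t ht ht0
    rw [htr] at ht
    have h2 : 0 < t ^ 2 := pow_pos ht0 2
    refine nonpos_of_mul_nonpos_right (le_of_eq_of_le ?_ ht) h2
    ring)
  have hobj : objective A ((2 : ℝ) • v) = 4 * objective A v := by
    simp only [objective, transpose_smul, Matrix.mul_smul, Matrix.smul_mul, trace_smul,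
      smul_eq_mul]
    ring
  rw [curveDirection_zero, hobj] at hle
  have : ∀ i, Λ i * (-2 * (∑ b, v i b ^ 2) / (1 + (0 : ℝ) ^ 2 * ∑ b, v i b ^ 2)) =
      -2 * (Λ i * ∑ b, v i b ^ 2) := by
    intro i; simp; ring
  simp_rw [this] at hle
  rw [← Finset.mul_sum] at hle
  linarith

/-! ### Deterministic correlation bounds under a bound on the noise. -/

/-- The quadratic form of a square array of real numbers. -/
noncomputable def quadForm {n : ℕ} (W : Fin n → Fin n → ℝ) (x : Fin n → ℝ) : ℝ :=
  ∑ i, ∑ j, W i j * (x i * x j)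

theorem quadForm_eq_sum_mulVec {n : ℕ} (W : Matrix (Fin n) (Fin n) ℝ) (x : Fin n → ℝ) :
    quadForm W x = ∑ i, x i * (W *ᵥ x) i := by
  simp only [quadForm, mulVec, dotProduct, Finset.mul_sum]
  refine Finset.sum_congr rfl fun i _ => Finset.sum_congr rfl fun j _ => by ring

theorem objective_eq_sum_quadForm {n k : ℕ} (A : Matrix (Fin n) (Fin n) ℝ)
    (σ : Matrix (Fin n) (Fin k) ℝ) :
    objective A σ = ∑ a, quadForm A fun i => σ i a := by
  simp only [objective, trace, diag, quadForm_eq_sum_mulVec, mul_apply, transpose_apply, mulVec,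
    dotProduct]

theorem quadForm_spikedMatrix {n : ℕ} (l : ℝ) (u : Fin n → ℝ) (W : Matrix (Fin n) (Fin n) ℝ)
    (x : Fin n → ℝ) :
    quadForm (spikedMatrix l u W) x = l / n * (∑ i, u i * x i) ^ 2 + quadForm W x := by
  rw [sq, Finset.sum_mul_sum]
  simp only [quadForm, spikedMatrix, Finset.mul_sum, ← Finset.sum_add_distrib]
  refine Finset.sum_congr rfl fun i _ => Finset.sum_congr rfl fun j _ => ?_
  simp only [Matrix.add_apply, Matrix.smul_apply, vecMulVec_apply, smul_eq_mul]
  ring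

theorem isSymm_spikedMatrix {n : ℕ} (l : ℝ) (u : Fin n → ℝ) {W : Matrix (Fin n) (Fin n) ℝ}
    (hW : W.IsSymm) : (spikedMatrix l u W).IsSymm := by
  ext i j
  have := hW.apply i j
  simp only [spikedMatrix, transpose_apply, Matrix.add_apply, Matrix.smul_apply, vecMulVec_apply,
    smul_eq_mul, this]
  ring

theorem correlation_eq {n k : ℕ} (u : Fin n → ℝ) (σ : Matrix (Fin n) (Fin k) ℝ) :
    correlation u σ = (∑ a, (∑ i, u i * σ i a) ^ 2) / (n : ℝ) ^ 2 := by
  simp only [correlation, EuclideanSpace.norm_sq_eq, Real.norm_eq_abs, sq_abs, mulVec, dotProduct,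
    transpose_apply, mul_comm]

/-- The `b`-th coordinate vector, projected to the tangent space at `σ i` and scaled by `w i`. -/
noncomputable def tangentFrame {n k : ℕ} (σ : Matrix (Fin n) (Fin k) ℝ) (w : Fin n → ℝ)
    (b : Fin k) : Matrix (Fin n) (Fin k) ℝ :=
  fun i a => w i * ((if a = b then 1 else 0) - σ i b * σ i a)

theorem tangentFrame_tangent {n k : ℕ} {σ : Matrix (Fin n) (Fin k) ℝ}
    (hσ : ∀ i, ∑ a, σ i a ^ 2 = 1) (w : Fin n → ℝ) (b : Fin k) (i : Fin n) :
    ∑ a, σ i a * tangentFrame σ w b i a = 0 := by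
  have : ∀ a, σ i a * tangentFrame σ w b i a =
      w i * (if a = b then σ i a else 0) - w i * σ i b * σ i a ^ 2 := by
    intro a
    simp only [tangentFrame]
    split_ifs <;> ring
  simp_rw [this]
  rw [Finset.sum_sub_distrib, ← Finset.mul_sum, ← Finset.mul_sum, hσ i]
  simp

theorem sum_tangentFrame_sq {n k : ℕ} {σ : Matrix (Fin n) (Fin k) ℝ}
    (hσ : ∀ i, ∑ a, σ i a ^ 2 = 1) (w : Fin n → ℝ) (b : Fin k) (i : Fin n) :
    ∑ a, tangentFrame σ w b i a ^ 2 = w i ^ 2 * (1 - σ i b ^ 2) := by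
  have : ∀ a, tangentFrame σ w b i a ^ 2 =
      w i ^ 2 * (if a = b then 1 - 2 * σ i b * σ i a else 0) + w i ^ 2 * σ i b ^ 2 * σ i a ^ 2 := by
    intro a
    simp only [tangentFrame]
    split_ifs <;> ring
  simp_rw [this]
  rw [Finset.sum_add_distrib, ← Finset.mul_sum, ← Finset.mul_sum, hσ i]
  simp
  ring

theorem sum_sum_tangentFrame_sq {n k : ℕ} {σ : Matrix (Fin n) (Fin k) ℝ}
    (hσ : ∀ i, ∑ a, σ i a ^ 2 = 1) (w : Fin n → ℝ) (i : Fin n) :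
    ∑ b, ∑ a, tangentFrame σ w b i a ^ 2 = (k - 1) * w i ^ 2 := by
  simp_rw [sum_tangentFrame_sq hσ]
  rw [← Finset.mul_sum, Finset.sum_sub_distrib, hσ i]
  simp
  ring

/-- Summing over the frame removes the dependence on the direction of `σ i`, since a tangent
projector has trace `k - 1`. The weight `w` is later the spike, or a single coordinate vector. -/
theorem sum_objective_tangentFrame_le {n k : ℕ} {A : Matrix (Fin n) (Fin n) ℝ}
    {σ : Matrix (Fin n) (Fin k) ℝ} (hA : A.IsSymm) (hσ : σ ∈ localMaximizers k A)
    (w : Fin n → ℝ) :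
    ∑ b, objective A (tangentFrame σ w b) ≤
      (k - 1) * ∑ i, (∑ b, σ i b * (A * σ) i b) * w i ^ 2 := by
  have hs := mem_rankManifold_iff.1 hσ.1
  refine (Finset.sum_le_sum fun b _ => localMaximizers_second_order hA hσ
    (tangentFrame_tangent hs w b)).trans (le_of_eq ?_)
  rw [Finset.sum_comm, Finset.mul_sum]
  refine Finset.sum_congr rfl fun i _ => ?_
  rw [← Finset.mul_sum, sum_sum_tangentFrame_sq hs]
  ring

theorem sum_sq_mulVec_le {n : ℕ} {W : Matrix (Fin n) (Fin n) ℝ} (hW : W.IsSymm) {K : ℝ}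
    (hK : 0 < K) (h : ∀ x, |quadForm W x| ≤ K * ∑ i, x i ^ 2) (x : Fin n → ℝ) :
    ∑ i, (W *ᵥ x) i ^ 2 ≤ K ^ 2 * ∑ i, x i ^ 2 := by
  set y := W *ᵥ x with hy
  have hsym : ∑ i, x i * (W *ᵥ y) i = ∑ i, y i ^ 2 := by
    have h1 : x ⬝ᵥ W *ᵥ y = y ⬝ᵥ W *ᵥ x := by
      rw [dotProduct_mulVec, ← mulVec_transpose, hW.eq, dotProduct_comm]
    simpa [dotProduct, ← hy, sq] using h1
  have hq : ∀ s : ℝ, quadForm W (x + s • y) =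
      quadForm W x + 2 * s * ∑ i, y i ^ 2 + s ^ 2 * quadForm W y := by
    intro s
    have e2 : ∑ i, y i * (W *ᵥ x) i = ∑ i, y i ^ 2 :=
      Finset.sum_congr rfl fun i _ => by rw [← hy, sq]
    have : ∀ i, (x + s • y) i * (W *ᵥ (x + s • y)) i = x i * (W *ᵥ x) i
        + s * (x i * (W *ᵥ y) i) + s * (y i * (W *ᵥ x) i) + s ^ 2 * (y i * (W *ᵥ y) i) := by
      intro i
      rw [mulVec_add, mulVec_smul]
      simp only [Pi.add_apply, Pi.smul_apply, smul_eq_mul]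
      ring
    simp_rw [quadForm_eq_sum_mulVec, this]
    rw [Finset.sum_add_distrib, Finset.sum_add_distrib, Finset.sum_add_distrib, ← Finset.mul_sum,
      ← Finset.mul_sum, ← Finset.mul_sum, e2, hsym]
    ring
  have hn : ∀ s : ℝ, ∑ i, (x + s • y) i ^ 2 =
      ∑ i, x i ^ 2 + 2 * s * ∑ i, x i * y i + s ^ 2 * ∑ i, y i ^ 2 := by
    intro s
    rw [Finset.mul_sum, Finset.mul_sum, ← Finset.sum_add_distrib, ← Finset.sum_add_distrib]
    refine Finset.sum_congr rfl fun i _ => ?_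
    simp only [Pi.add_apply, Pi.smul_apply, smul_eq_mul]
    ring
  -- Polarization: the difference of the form at `x ± K⁻¹ • y` isolates `4 K⁻¹ ‖y‖²`, and this step
  -- size balances the two norm terms.
  have h1 := (abs_le.1 (h (x + K⁻¹ • y))).2
  have h2 := (abs_le.1 (h (x + (-K⁻¹) • y))).1
  rw [hq, hn] at h1 h2
  have h3 : 4 * K⁻¹ * ∑ i, y i ^ 2 ≤ 2 * K * ∑ i, x i ^ 2 + 2 * (K * K⁻¹ ^ 2) * ∑ i, y i ^ 2 := by
    linarith
  have h4 : K * K⁻¹ ^ 2 = K⁻¹ := by field_simp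
  rw [h4] at h3
  have h5 : K⁻¹ * ∑ i, y i ^ 2 ≤ K * ∑ i, x i ^ 2 := by linarith
  rw [inv_mul_le_iff₀ hK] at h5
  linarith

theorem neg_mul_le_quadForm_spikedMatrix {n : ℕ} {l K : ℝ} (u : Fin n → ℝ)
    {W : Matrix (Fin n) (Fin n) ℝ} (h : ∀ x, |quadForm W x| ≤ K * ∑ i, x i ^ 2)
    (x : Fin n → ℝ) :
    l / n * (∑ i, u i * x i) ^ 2 - K * ∑ i, x i ^ 2 ≤ quadForm (spikedMatrix l u W) x := by
  rw [quadForm_spikedMatrix]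
  linarith [(abs_le.1 (h x)).1]

/-- The correlation bound obtained by testing the second-order condition with the spike. -/
theorem correlation_ge_of_localMaximizer {n k : ℕ} (hn : 0 < n) (hk : 2 ≤ k) {l K : ℝ}
    (hl : 0 < l) {u : Fin n → ℝ} (hu : ∀ i, u i ^ 2 = 1) {W : Matrix (Fin n) (Fin n) ℝ}
    (hW : W.IsSymm) (h : ∀ x, |quadForm W x| ≤ K * ∑ i, x i ^ 2)
    {σ : Matrix (Fin n) (Fin k) ℝ} (hσ : σ ∈ localMaximizers k (spikedMatrix l u W)) :
    1 - 1 / (k : ℝ) - 2 * K / l ≤ correlation u σ := by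
  have hs := mem_rankManifold_iff.1 hσ.1
  have hn' : (0 : ℝ) < n := by exact_mod_cast hn
  have hk' : (2 : ℝ) ≤ k := by exact_mod_cast hk
  have hmain := sum_objective_tangentFrame_le (isSymm_spikedMatrix l u hW) hσ u
  set A := spikedMatrix l u W with hAdef
  have hR : ∑ i, (∑ b, σ i b * (A * σ) i b) * u i ^ 2 = objective A σ := by
    simp only [hu, mul_one]
    rw [objective, trace_transpose_mul]
  have hobj : objective A σ ≤ l * n * correlation u σ + K * n := by
    have h1 : ∀ a, quadForm A (fun i => σ i a) ≤
        l / n * (∑ i, u i * σ i a) ^ 2 + K * ∑ i, σ i a ^ 2 := by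
      intro a
      rw [hAdef, quadForm_spikedMatrix]
      linarith [(abs_le.1 (h fun i => σ i a)).2]
    rw [objective_eq_sum_quadForm]
    refine (Finset.sum_le_sum fun a _ => h1 a).trans (le_of_eq ?_)
    rw [Finset.sum_add_distrib, ← Finset.mul_sum, ← Finset.mul_sum, Finset.sum_comm, correlation_eq]
    simp only [hs, Finset.sum_const, Finset.card_univ, Fintype.card_fin, nsmul_eq_mul, mul_one]
    field_simp
  have hL : l * n * (k - 1) ^ 2 / k - K * ((k - 1) * n) ≤
      ∑ b, objective A (tangentFrame σ u b) := by
    -- Only column `b` of frame element `b` is kept in the spike term; the squares from other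
    -- columns are dropped.
    have h1 : ∀ b, l / n * (∑ i, (1 - σ i b ^ 2)) ^ 2
        - K * ∑ i, ∑ a, tangentFrame σ u b i a ^ 2 ≤ objective A (tangentFrame σ u b) := by
      intro b
      have e : ∑ i, (1 - σ i b ^ 2) = ∑ i, u i * tangentFrame σ u b i b :=
        Finset.sum_congr rfl fun i _ => by
          simp only [tangentFrame, if_true]
          rw [← mul_assoc, ← sq, hu]; ring
      rw [objective_eq_sum_quadForm, e, Finset.sum_comm, Finset.mul_sum]
      refine le_trans ?_ (Finset.sum_le_sum fun a _ => neg_mul_le_quadForm_spikedMatrix u h _)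
      rw [Finset.sum_sub_distrib]
      refine sub_le_sub_right ?_ _
      exact Finset.single_le_sum
        (f := fun a => l / n * (∑ i, u i * tangentFrame σ u b i a) ^ 2)
        (fun a _ => by positivity) (Finset.mem_univ b)
    refine le_trans ?_ (Finset.sum_le_sum fun b _ => h1 b)
    rw [Finset.sum_sub_distrib, ← Finset.mul_sum, ← Finset.mul_sum]
    refine sub_le_sub ?_ (le_of_eq ?_)
    -- Cauchy–Schwarz over `b`: the `k` column sums add up to `n (k - 1)`.
    · have hcs := sq_sum_le_card_mul_sum_sq (s := Finset.univ)
        (f := fun b : Fin k => ∑ i, (1 - σ i b ^ 2))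
      have hsum : ∑ b : Fin k, ∑ i, (1 - σ i b ^ 2) = (n : ℝ) * ((k : ℝ) - 1) := by
        rw [Finset.sum_comm]
        simp [Finset.sum_sub_distrib, hs]
        ring
      rw [hsum, Finset.card_univ, Fintype.card_fin] at hcs
      have : l * n * (k - 1) ^ 2 / k = l / n * ((n * (k - 1)) ^ 2 / k) := by
        field_simp
      rw [this]
      refine mul_le_mul_of_nonneg_left ?_ (by positivity)
      rw [div_le_iff₀' (by positivity)]
      exact hcs
    · rw [Finset.sum_comm]
      simp only [sum_sum_tangentFrame_sq hs, hu, mul_one, Finset.sum_const, Finset.card_univ,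
        Fintype.card_fin, nsmul_eq_mul]
      ring
  rw [hR] at hmain
  have h2 : l * n * (k - 1) ^ 2 / k - K * ((k - 1) * n) ≤
      (k - 1) * (l * n * correlation u σ + K * n) :=
    (hL.trans hmain).trans (mul_le_mul_of_nonneg_left hobj (by linarith))
  have h3 : l * n * (k - 1) ^ 2 / k - K * ((k - 1) * n) - (k - 1) * (K * n) =
      (k - 1) * l * n * (1 - 1 / (k : ℝ) - 2 * K / l) := by
    field_simp
    ring
  have h4 : (0 : ℝ) < (k - 1) * l * n := mul_pos (mul_pos (by linarith) hl) hn'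
  refine le_of_mul_le_mul_left ?_ h4
  rw [← h3]
  linarith

/-- The multipliers at a local maximizer are bounded below. -/
theorem neg_le_multiplier {n k : ℕ} (hk : 2 ≤ k) {l K : ℝ}
    (hl : 0 < l) {u : Fin n → ℝ} {W : Matrix (Fin n) (Fin n) ℝ}
    (hW : W.IsSymm) (h : ∀ x, |quadForm W x| ≤ K * ∑ i, x i ^ 2)
    {σ : Matrix (Fin n) (Fin k) ℝ} (hσ : σ ∈ localMaximizers k (spikedMatrix l u W))
    (i : Fin n) :
    -K ≤ ∑ b, σ i b * (spikedMatrix l u W * σ) i b := by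
  have hs := mem_rankManifold_iff.1 hσ.1
  have hk' : (2 : ℝ) ≤ k := by exact_mod_cast hk
  have hmain := sum_objective_tangentFrame_le (isSymm_spikedMatrix l u hW) hσ (Pi.single i 1)
  set A := spikedMatrix l u W with hAdef
  have h1 : ∀ b, -K * ∑ j, ∑ a, tangentFrame σ (Pi.single i 1) b j a ^ 2 ≤
      objective A (tangentFrame σ (Pi.single i 1) b) := by
    intro b
    rw [objective_eq_sum_quadForm, Finset.sum_comm, Finset.mul_sum]
    refine Finset.sum_le_sum fun a _ => le_trans ?_ (neg_mul_le_quadForm_spikedMatrix u h _)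
    have : 0 ≤ l / n * (∑ j, u j * tangentFrame σ (Pi.single i 1) b j a) ^ 2 := by positivity
    linarith
  have h2 := (Finset.sum_le_sum fun b (_ : b ∈ Finset.univ) => h1 b).trans hmain
  rw [← Finset.mul_sum, Finset.sum_comm] at h2
  simp only [sum_sum_tangentFrame_sq hs, Pi.single_apply, ite_pow, one_pow, ne_eq,
    OfNat.ofNat_ne_zero, not_false_eq_true, zero_pow, mul_ite, mul_one, mul_zero,
    Finset.sum_ite_eq', Finset.mem_univ, if_true] at h2
  refine le_of_mul_le_mul_left ?_ (show (0 : ℝ) < k - 1 by linarith)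
  linarith

/-- The right side is `‖Λ σ i - l u i m‖²` with `‖m‖ = M` and `c = u i ⟨m, σ i⟩`. For `c ≥ 0`,
completing the square in `Λ` leaves `l² (M² - c²)`. For `c ≤ 0`, a very negative `Λ` could cancel
everything; `Λ ≥ -K` and `4K ≤ lM` keep at least `l² M² / 2`. A lower bound linear in `c` is what
can be summed over rows. -/
theorem alignment_defect_le {Λ K l M c : ℝ} (hl : 0 < l) (hM : 0 < M) (hK : 0 ≤ K)
    (hΛ : -K ≤ Λ) (hc : |c| ≤ M) (hKM : 4 * K ≤ l * M) :
    l ^ 2 / 4 * (M ^ 2 - c * M) ≤ Λ ^ 2 - 2 * Λ * l * c + l ^ 2 * M ^ 2 := by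
  obtain ⟨hc1, hc2⟩ := abs_le.1 hc
  have hl2 : 0 < l ^ 2 := by positivity
  rcases le_total 0 c with h0 | h0
  · have h1 : c ^ 2 ≤ c * M := by nlinarith
    have h2 : c * M ≤ M ^ 2 := by nlinarith
    have h3 := mul_le_mul_of_nonneg_left h1 hl2.le
    have h4 := mul_le_mul_of_nonneg_left h2 hl2.le
    nlinarith [sq_nonneg (Λ - l * c)]
  · have h1 : l ^ 2 / 4 * (M ^ 2 - c * M) ≤ l ^ 2 * M ^ 2 / 2 := by
      have : M ^ 2 - c * M ≤ 2 * M ^ 2 := by nlinarith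
      nlinarith
    have h2 : -(K * M) ≤ -(Λ * c) := by
      rcases le_total 0 Λ with h | h
      · nlinarith [mul_nonneg h (neg_nonneg.2 h0), mul_nonneg hK hM.le]
      · have : -Λ * -c ≤ K * M :=
          mul_le_mul (by linarith) (by linarith) (by linarith) hK
        linarith
    have h3 := mul_le_mul_of_nonneg_left h2 hl.le
    have h4 := mul_le_mul_of_nonneg_right hKM (mul_pos hl hM).le
    nlinarith [sq_nonneg Λ]

theorem correlation_nonneg {n k : ℕ} (u : Fin n → ℝ) (σ : Matrix (Fin n) (Fin k) ℝ) :
    0 ≤ correlation u σ := by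
  unfold correlation
  positivity

/-- The bound obtained from the first-order condition, when the spike dominates the noise. -/
theorem sq_mul_one_sub_sqrt_correlation_le {n k : ℕ} (hn : 0 < n) (hk : 2 ≤ k) {l K : ℝ}
    (hl : 0 < l) (hK : 0 < K) {u : Fin n → ℝ} (hu : ∀ i, u i ^ 2 = 1)
    {W : Matrix (Fin n) (Fin n) ℝ} (hW : W.IsSymm) (h : ∀ x, |quadForm W x| ≤ K * ∑ i, x i ^ 2)
    {σ : Matrix (Fin n) (Fin k) ℝ} (hσ : σ ∈ localMaximizers k (spikedMatrix l u W)) {M : ℝ}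
    (hM : 0 < M) (hMX : M ^ 2 = correlation u σ) (hKM : 4 * K ≤ l * M) :
    l ^ 2 / 4 * (M ^ 2 - M ^ 3) ≤ K ^ 2 := by
  have hs := mem_rankManifold_iff.1 hσ.1
  have hn' : (0 : ℝ) < n := by exact_mod_cast hn
  set A := spikedMatrix l u W with hAdef
  set Λ : Fin n → ℝ := fun i => ∑ b, σ i b * (A * σ) i b with hΛdef
  have hΛ : ∀ i, -K ≤ Λ i := neg_le_multiplier hk hl hW h hσ
  have hfirst : ∀ i a, (A * σ) i a = Λ i * σ i a :=
    localMaximizers_first_order (isSymm_spikedMatrix l u hW) hσ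
  set m : Fin k → ℝ := fun a => (∑ j, u j * σ j a) / n with hm
  have hmM : ∑ a, m a ^ 2 = M ^ 2 := by
    rw [hMX, correlation_eq, Finset.sum_div]
    exact Finset.sum_congr rfl fun a _ => by rw [hm, div_pow]
  set c : Fin n → ℝ := fun i => u i * ∑ a, m a * σ i a with hc
  have hcM : ∀ i, |c i| ≤ M := by
    intro i
    refine abs_le_of_sq_le_sq ?_ hM.le
    have := Finset.sum_mul_sq_le_sq_mul_sq Finset.univ m (fun a => σ i a)
    rw [hs i, hmM, mul_one] at this
    rw [hc, mul_pow, hu, one_mul]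
    exact this
  -- The mean of `c` is `M²`, whereas full alignment would make every `c i` equal to `M`; the gap
  -- produces `M² - M³`.
  have hcsum : ∑ i, c i = n * M ^ 2 := by
    rw [← hmM, Finset.mul_sum]
    simp only [hc, Finset.mul_sum]
    rw [Finset.sum_comm]
    refine Finset.sum_congr rfl fun a _ => ?_
    have : ∀ i, u i * (m a * σ i a) = m a * (u i * σ i a) := fun i => by ring
    simp_rw [this]
    rw [← Finset.mul_sum, sq, ← mul_assoc, mul_comm, mul_comm (n : ℝ)]
    congr 1
    simp only [hm]
    field_simp
  have hz : ∀ i a, (W * σ) i a = Λ i * σ i a - l * u i * m a := by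
    intro i a
    rw [← hfirst]
    have : (A * σ) i a = l * u i * m a + (W * σ) i a := by
      rw [hAdef, spikedMatrix, Matrix.add_mul, Matrix.add_apply, Matrix.smul_mul,
        Matrix.smul_apply, smul_eq_mul, mul_apply]
      simp only [vecMulVec_apply, hm, mul_assoc, ← Finset.mul_sum]
      ring
    rw [this]; ring
  have hrow : ∀ i, ∑ a, (W * σ) i a ^ 2 = Λ i ^ 2 - 2 * Λ i * l * c i + l ^ 2 * M ^ 2 := by
    intro i
    have : ∀ a, (W * σ) i a ^ 2 = Λ i ^ 2 * σ i a ^ 2 - 2 * Λ i * l * u i * (m a * σ i a)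
        + l ^ 2 * m a ^ 2 := by
      intro a
      rw [hz]
      linear_combination l ^ 2 * m a ^ 2 * hu i
    simp_rw [this]
    rw [Finset.sum_add_distrib, Finset.sum_sub_distrib, ← Finset.mul_sum, ← Finset.mul_sum,
      ← Finset.mul_sum, hs i, hmM]
    simp only [hc]
    ring
  have htot : ∑ i, ∑ a, (W * σ) i a ^ 2 ≤ K ^ 2 * n := by
    rw [Finset.sum_comm]
    have h1 : ∀ a, ∑ i, (W * σ) i a ^ 2 ≤ K ^ 2 * ∑ i, σ i a ^ 2 := fun a =>
      sum_sq_mulVec_le hW hK h fun i => σ i a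
    refine (Finset.sum_le_sum fun a _ => h1 a).trans (le_of_eq ?_)
    rw [← Finset.mul_sum, Finset.sum_comm]
    simp [hs]
  have hlow : ∑ i, l ^ 2 / 4 * (M ^ 2 - c i * M) ≤ K ^ 2 * n := by
    refine le_trans (Finset.sum_le_sum fun i _ => ?_) htot
    rw [hrow i]
    exact alignment_defect_le hl hM hK.le (hΛ i) (hcM i) hKM
  rw [← Finset.mul_sum, Finset.sum_sub_distrib, ← Finset.sum_mul, hcsum] at hlow
  simp only [Finset.sum_const, Finset.card_univ, Fintype.card_fin, nsmul_eq_mul] at hlow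
  refine le_of_mul_le_mul_right ?_ hn'
  linarith

/-- The deterministic part of the argument: if the quadratic form of the noise is bounded by `K`,
with `K` close to two, then every local maximizer is correlated with the spike. -/
theorem correlation_ge {n k : ℕ} (hn : 0 < n) (hk : 2 ≤ k) {l K : ℝ}
    (hl : 0 < l) (hK2 : 2 ≤ K) (hK : K ≤ 21 / 10) {u : Fin n → ℝ} (hu : ∀ i, u i ^ 2 = 1)
    {W : Matrix (Fin n) (Fin n) ℝ} (hW : W.IsSymm) (h : ∀ x, |quadForm W x| ≤ K * ∑ i, x i ^ 2)
    {σ : Matrix (Fin n) (Fin k) ℝ} (hσ : σ ∈ localMaximizers k (spikedMatrix l u W)) :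
    1 - min (16 / l) (1 / (k : ℝ) + 2 * K / l) ≤ correlation u σ := by
  have h1 := correlation_ge_of_localMaximizer hn hk hl hu hW h hσ
  have hk' : (2 : ℝ) ≤ k := by exact_mod_cast hk
  rcases le_or_gt (1 / (k : ℝ) + 2 * K / l) (16 / l) with hc | hc
  · rw [min_eq_right hc]
    linarith
  rw [min_eq_left hc.le]
  have hk2 : 1 / (k : ℝ) ≤ 1 / 2 := one_div_le_one_div_of_le (by norm_num) hk'
  -- If `16 / l` is the smaller bound, `l` is large, and the first bound already gives correlation
  -- above `0.31`. This starts the refined estimate, as then `4K ≤ 8.4 ≤ l M`.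
  have hlbig : 23 ≤ l := by
    have h2 : 16 / l < 1 / 2 + 2 * K / l := hc.trans_le (by linarith)
    rw [div_add_div _ _ (by norm_num) hl.ne', div_lt_div_iff₀ hl (by positivity)] at h2
    nlinarith
  have hKl : 2 * K / l ≤ 4.2 / 23 := by
    rw [div_le_div_iff₀ hl (by norm_num)]
    nlinarith
  have hX : 31 / 100 ≤ correlation u σ := by
    norm_num at hKl
    linarith
  obtain ⟨M, hMdef⟩ : ∃ M, M = √(correlation u σ) := ⟨_, rfl⟩
  have hMX : M ^ 2 = correlation u σ := by
    rw [hMdef]; exact Real.sq_sqrt (correlation_nonneg u σ)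
  have hM : 11 / 20 ≤ M := by
    rw [hMdef]
    exact Real.le_sqrt_of_sq_le (le_trans (by norm_num) hX)
  have h3 := sq_mul_one_sub_sqrt_correlation_le hn hk hl (by linarith) hu hW h hσ
    (by linarith) hMX (by nlinarith)
  rw [← hMX] at hX ⊢
  rcases le_or_gt 1 M with hM1 | hM1
  · have : 0 < 16 / l := by positivity
    nlinarith
  have h4 : l ^ 2 / 4 * (31 / 100 * (1 - M)) ≤ 4.41 := by
    have : 31 / 100 * (1 - M) ≤ M ^ 2 - M ^ 3 := by nlinarith
    have h5 := mul_le_mul_of_nonneg_left this (show 0 ≤ l ^ 2 / 4 by positivity)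
    nlinarith
  -- The preceding estimate is of order `l⁻²`; `23 ≤ l` weakens it to order `l⁻¹`, and `1 - M² ≤ 2
  -- (1 - M)` yields `16 / l`.
  have h6 : 1 - M ≤ 8 / l := by
    rw [le_div_iff₀ hl]
    nlinarith [mul_nonneg (sub_nonneg.2 hM1.le) hl.le]
  have h7 : 16 / l = 2 * (8 / l) := by ring
  rw [h7]
  nlinarith

/-! ### The GOE law, its characteristic function and orthogonal invariance. -/

/-- The symmetric array with corner entry `a`, first row `b` and remaining block `W`. -/
def borderedArray {n : ℕ} (a : ℝ) (b : Fin n → ℝ) (W : Fin n → Fin n → ℝ) :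
    Fin (n + 1) → Fin (n + 1) → ℝ :=
  Fin.cons (Fin.cons a b) fun i => Fin.cons (b i) (W i)

theorem measurable_borderedArray {n : ℕ} :
    Measurable fun p : ℝ × (Fin n → ℝ) × (Fin n → Fin n → ℝ) =>
      borderedArray p.1 p.2.1 p.2.2 := by
  refine measurable_pi_lambda _ fun i => measurable_pi_lambda _ fun j => ?_
  refine Fin.cases ?_ (fun i => ?_) i <;> refine Fin.cases ?_ (fun j => ?_) j <;>
    simp only [borderedArray, Fin.cons_zero, Fin.cons_succ] <;> fun_prop

/-- The law of the Gaussian orthogonal ensemble with off-diagonal variance `v`, built by adding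
one row and column at a time. -/
noncomputable def goe (v : NNReal) : (n : ℕ) → Measure (Fin n → Fin n → ℝ)
  | 0 => Measure.dirac 0
  | n + 1 => ((gaussianReal 0 (2 * v)).prod
      ((Measure.pi fun _ : Fin n => gaussianReal 0 v).prod (goe v n))).map
        fun p => borderedArray p.1 p.2.1 p.2.2

instance isProbabilityMeasure_goe (v : NNReal) (n : ℕ) : IsProbabilityMeasure (goe v n) := by
  induction n with
  | zero => unfold goe; infer_instance
  | succ n ih =>
    unfold goe
    exact Measure.isProbabilityMeasure_map measurable_borderedArray.aemeasurable

theorem integral_cexp_gaussianReal (v : NNReal) (t : ℝ) :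
    ∫ x, Complex.exp (((t * x : ℝ) : ℂ) * Complex.I) ∂gaussianReal 0 v =
      Complex.exp ((-(v * t ^ 2 / 2) : ℝ) : ℂ) := by
  have h := charFun_gaussianReal (μ := 0) (v := v) t
  rw [charFun_apply_real] at h
  push_cast at h ⊢
  rw [h]
  congr 1
  ring

theorem integral_cexp_pi_gaussianReal {ι : Type*} [Fintype ι] (v : NNReal) (t : ι → ℝ) :
    ∫ x : ι → ℝ, Complex.exp (((∑ j, t j * x j : ℝ) : ℂ) * Complex.I)
      ∂Measure.pi (fun _ => gaussianReal 0 v) =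
      Complex.exp ((-(v * (∑ j, t j ^ 2) / 2) : ℝ) : ℂ) := by
  simp_rw [Complex.ofReal_sum, Finset.sum_mul, Complex.exp_sum]
  rw [integral_fintype_prod_eq_prod
    (f := fun j (y : ℝ) => Complex.exp (((t j * y : ℝ) : ℂ) * Complex.I))]
  simp_rw [integral_cexp_gaussianReal]
  rw [← Complex.exp_sum, ← Complex.ofReal_sum]
  congr 2
  rw [Finset.mul_sum, Finset.sum_div, Finset.sum_neg_distrib]

/-- The independent corner, first row and block factor the integral. The answer involves only the
Frobenius norm of `B + Bᵀ`, which makes orthogonal invariance visible. -/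
theorem integral_cexp_goe (v : NNReal) (n : ℕ) (B : Fin n → Fin n → ℝ) :
    ∫ W, Complex.exp (((∑ i, ∑ j, B i j * W i j : ℝ) : ℂ) * Complex.I) ∂goe v n =
      Complex.exp ((-(v / 4 * ∑ i, ∑ j, (B i j + B j i) ^ 2) : ℝ) : ℂ) := by
  induction n with
  | zero => simp
  | succ n ih =>
    have hm : Measurable fun W : Fin (n + 1) → Fin (n + 1) → ℝ =>
        Complex.exp (((∑ i, ∑ j, B i j * W i j : ℝ) : ℂ) * Complex.I) := by fun_prop
    rw [goe, integral_map measurable_borderedArray.aemeasurable hm.aestronglyMeasurable]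
    have hsplit : ∀ p : ℝ × (Fin n → ℝ) × (Fin n → Fin n → ℝ),
        Complex.exp (((∑ i, ∑ j, B i j * borderedArray p.1 p.2.1 p.2.2 i j : ℝ) : ℂ) * Complex.I)
        = Complex.exp (((B 0 0 * p.1 : ℝ) : ℂ) * Complex.I) *
          (Complex.exp (((∑ j, (B 0 j.succ + B j.succ 0) * p.2.1 j : ℝ) : ℂ) * Complex.I) *
           Complex.exp (((∑ i : Fin n, ∑ j : Fin n, B i.succ j.succ * p.2.2 i j : ℝ) : ℂ)
              * Complex.I)) := by
      intro p
      rw [← Complex.exp_add, ← Complex.exp_add, ← add_mul, ← add_mul, ← Complex.ofReal_add,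
        ← Complex.ofReal_add]
      congr 3
      simp only [borderedArray, Fin.sum_univ_succ, Fin.cons_zero, Fin.cons_succ, add_mul,
        Finset.sum_add_distrib]
      ring
    simp_rw [hsplit]
    rw [integral_prod_mul (fun a : ℝ => Complex.exp (((B 0 0 * a : ℝ) : ℂ) * Complex.I))
      (fun q : (Fin n → ℝ) × (Fin n → Fin n → ℝ) =>
        Complex.exp (((∑ j, (B 0 j.succ + B j.succ 0) * q.1 j : ℝ) : ℂ) * Complex.I) *
        Complex.exp (((∑ i : Fin n, ∑ j : Fin n, B i.succ j.succ * q.2 i j : ℝ) : ℂ)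
          * Complex.I)),
      integral_prod_mul (fun b : Fin n → ℝ =>
        Complex.exp (((∑ j, (B 0 j.succ + B j.succ 0) * b j : ℝ) : ℂ) * Complex.I))
        (fun W : Fin n → Fin n → ℝ =>
        Complex.exp (((∑ i : Fin n, ∑ j : Fin n, B i.succ j.succ * W i j : ℝ) : ℂ)
          * Complex.I)),
      integral_cexp_gaussianReal, integral_cexp_pi_gaussianReal,
      ih fun i j => B i.succ j.succ, ← Complex.exp_add, ← Complex.exp_add, ← Complex.ofReal_add,
      ← Complex.ofReal_add]
    congr 2
    simp only [Fin.sum_univ_succ, NNReal.coe_mul, NNReal.coe_ofNat, Finset.sum_add_distrib]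
    have : ∑ i : Fin n, (B i.succ 0 + B 0 i.succ) ^ 2 = ∑ i : Fin n, (B 0 i.succ + B i.succ 0) ^ 2 :=
      Finset.sum_congr rfl fun i _ => by rw [add_comm]
    rw [this]
    ring

/-- A finite measure on square arrays is determined by the characteristic function of the
entrywise pairings. -/
theorem ext_of_integral_cexp_pairing {n : ℕ} {μ ν : Measure (Fin n → Fin n → ℝ)}
    [IsFiniteMeasure μ] [IsFiniteMeasure ν]
    (h : ∀ B : Fin n → Fin n → ℝ,
      ∫ W, Complex.exp (((∑ i, ∑ j, B i j * W i j : ℝ) : ℂ) * Complex.I) ∂μ =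
      ∫ W, Complex.exp (((∑ i, ∑ j, B i j * W i j : ℝ) : ℂ) * Complex.I) ∂ν) : μ = ν := by
  refine Measure.ext_of_charFunDual (funext fun L => ?_)
  have hL : ∀ W : Fin n → Fin n → ℝ, L W =
      ∑ i, ∑ j, L (Pi.single i (Pi.single j 1)) * W i j := by
    intro W
    have e : W = ∑ i, ∑ j, W i j • (Pi.single i (Pi.single j 1) : Fin n → Fin n → ℝ) := by
      ext i j
      simp only [Finset.sum_apply, Pi.smul_apply, Pi.single_apply, ite_apply, Pi.zero_apply,
        smul_eq_mul, mul_ite, mul_one, mul_zero]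
      rw [Finset.sum_eq_single i (fun c _ hc => by simp [hc.symm]) (by simp)]
      simp
    conv_lhs => rw [e]
    simp only [map_sum, map_smul, smul_eq_mul]
    exact Finset.sum_congr rfl fun i _ => Finset.sum_congr rfl fun j _ => mul_comm _ _
  have hexp : ∀ W : Fin n → Fin n → ℝ, Complex.exp (L W * Complex.I) =
      Complex.exp (((∑ i, ∑ j, L (Pi.single i (Pi.single j 1)) * W i j : ℝ) : ℂ) * Complex.I) :=
    fun W => by rw [← hL W]
  rw [charFunDual_apply, charFunDual_apply, integral_congr_ae (Eventually.of_forall hexp),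
    integral_congr_ae (Eventually.of_forall hexp)]
  exact h _

theorem sum_sum_mul_eq_trace {n : ℕ} (B W : Matrix (Fin n) (Fin n) ℝ) :
    ∑ i, ∑ j, B i j * W i j = trace (Bᵀ * W) := by
  simp only [trace, diag, mul_apply, transpose_apply]
  exact Finset.sum_comm

/-- The ensemble is invariant under conjugation by orthogonal matrices. -/
theorem map_conj_goe (v : NNReal) {n : ℕ} {H : Matrix (Fin n) (Fin n) ℝ} (hH : Hᵀ * H = 1) :
    (goe v n).map (fun W : Fin n → Fin n → ℝ => (fun i j => (Hᵀ * (Matrix.of W * H)) i j)) =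
      goe v n := by
  have hmeas : Measurable
      (fun W : Fin n → Fin n → ℝ => (fun i j => (Hᵀ * (Matrix.of W * H)) i j)) := by
    refine measurable_pi_lambda _ fun i => measurable_pi_lambda _ fun j => ?_
    simp only [mul_apply, of_apply]
    fun_prop
  have : IsProbabilityMeasure ((goe v n).map
      (fun W : Fin n → Fin n → ℝ => (fun i j => (Hᵀ * (Matrix.of W * H)) i j))) :=
    Measure.isProbabilityMeasure_map hmeas.aemeasurable
  refine ext_of_integral_cexp_pairing fun B => ?_
  have hm : Measurable fun W : Fin n → Fin n → ℝ =>
      Complex.exp (((∑ i, ∑ j, B i j * W i j : ℝ) : ℂ) * Complex.I) := by fun_prop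
  rw [integral_map hmeas.aemeasurable hm.aestronglyMeasurable, integral_cexp_goe]
  -- Cyclicity of the trace moves the conjugation from `W` to `B`.
  have hpair : ∀ W : Fin n → Fin n → ℝ, ∑ i, ∑ j, B i j * (Hᵀ * (Matrix.of W * H)) i j =
      ∑ i, ∑ j, (H * Matrix.of B * Hᵀ) i j * W i j := by
    intro W
    have e1 := sum_sum_mul_eq_trace (Matrix.of B) (Hᵀ * (Matrix.of W * H))
    have e2 := sum_sum_mul_eq_trace (H * Matrix.of B * Hᵀ) (Matrix.of W)
    simp only [of_apply] at e1 e2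
    rw [e1, e2, transpose_mul, transpose_mul, transpose_transpose, ← Matrix.mul_assoc,
      ← Matrix.mul_assoc, trace_mul_comm]
    simp only [Matrix.mul_assoc]
  simp_rw [hpair]
  refine (integral_cexp_goe v n fun i j => (H * Matrix.of B * Hᵀ) i j).trans ?_
  congr 4
  have hS : ∀ C : Matrix (Fin n) (Fin n) ℝ, ∑ i, ∑ j, (C i j + C j i) ^ 2 =
      trace ((C + Cᵀ)ᵀ * (C + Cᵀ)) := by
    intro C
    rw [← sum_sum_mul_eq_trace]
    simp only [Matrix.add_apply, transpose_apply, sq]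
  have e3 : H * Matrix.of B * Hᵀ + (H * Matrix.of B * Hᵀ)ᵀ =
      H * (Matrix.of B + (Matrix.of B)ᵀ) * Hᵀ := by
    simp only [transpose_mul, transpose_transpose, Matrix.mul_add, Matrix.add_mul,
      Matrix.mul_assoc]
  have e4 := hS (Matrix.of B)
  simp only [of_apply] at e4
  rw [hS, e3, e4]
  set S := Matrix.of B + (Matrix.of B)ᵀ
  rw [transpose_mul, transpose_mul, transpose_transpose]
  calc trace (H * (Sᵀ * Hᵀ) * (H * S * Hᵀ))
      = trace (H * (Sᵀ * (Hᵀ * H) * S) * Hᵀ) := by simp only [Matrix.mul_assoc]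
    _ = trace (Hᵀ * (H * (Sᵀ * (Hᵀ * H) * S))) := trace_mul_comm _ _
    _ = trace (Sᵀ * S) := by rw [← Matrix.mul_assoc, hH, Matrix.one_mul, Matrix.mul_one]

/-- A sum over all pairs, folded onto the pairs on and above the diagonal. -/
theorem sum_sum_eq_sum_upper {M : Type*} [AddCommMonoid M] {n : ℕ} (F : Fin n → Fin n → M) :
    ∑ i, ∑ j, F i j = ∑ p : {p : Fin n × Fin n // p.1 ≤ p.2},
      if p.1.1 = p.1.2 then F p.1.1 p.1.1 else F p.1.1 p.1.2 + F p.1.2 p.1.1 := by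
  have h1 : (∑ p : {p : Fin n × Fin n // p.1 ≤ p.2},
      if p.1.1 = p.1.2 then F p.1.1 p.1.1 else F p.1.1 p.1.2 + F p.1.2 p.1.1) =
      ∑ i, ∑ j, if i ≤ j then (if i = j then F i i else F i j + F j i) else 0 := by
    rw [← Finset.sum_product', Finset.univ_product_univ, ← Finset.sum_filter]
    exact (Finset.sum_subtype (Finset.univ.filter fun p : Fin n × Fin n => p.1 ≤ p.2)
      (by simp) fun p => if p.1 = p.2 then F p.1 p.1 else F p.1 p.2 + F p.2 p.1).symm
  have h2 : ∀ i j, (if i ≤ j then (if i = j then F i i else F i j + F j i) else 0) =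
      (if i ≤ j then F i j else 0) + if i < j then F j i else 0 := by
    intro i j
    rcases lt_trichotomy i j with h | h | h
    · simp [h.le, h.ne, h]
    · simp [h]
    · simp [h.not_ge, h.not_gt]
  rw [h1]
  simp_rw [h2, Finset.sum_add_distrib]
  rw [Finset.sum_comm (f := fun i j => if i < j then F j i else 0)]
  simp_rw [← Finset.sum_add_distrib]
  refine Finset.sum_congr rfl fun i _ => Finset.sum_congr rfl fun j _ => ?_
  rcases le_or_gt i j with h | h
  · simp [h, h.not_gt]
  · simp [h, h.not_ge]

theorem IsGOE.aemeasurable {Ω : Type*} [MeasurableSpace Ω] {P : Measure Ω} {n : ℕ}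
    {W : Ω → Matrix (Fin n) (Fin n) ℝ} (hW : IsGOE P n W) (i j : Fin n) :
    AEMeasurable (fun ω => W ω i j) P := by
  rcases lt_trichotomy i j with h | h | h
  · exact (hW.law_upper i j h).aemeasurable
  · rw [h]
    exact (hW.law_diag j).aemeasurable
  · refine (hW.law_upper j i h).aemeasurable.congr ?_
    filter_upwards [hW.symm] with ω hω
    exact hω.apply i j

theorem IsGOE.law_of_le {Ω : Type*} [MeasurableSpace Ω] {P : Measure Ω} {n : ℕ}
    {W : Ω → Matrix (Fin n) (Fin n) ℝ} (hW : IsGOE P n W)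
    (p : {p : Fin n × Fin n // p.1 ≤ p.2}) :
    HasLaw (fun ω => W ω p.1.1 p.1.2)
      (gaussianReal 0 (if p.1.1 = p.1.2 then 2 / n else 1 / n)) P := by
  obtain ⟨⟨i, j⟩, hij⟩ := p
  rcases eq_or_lt_of_le hij with h | h
  · simp only at h
    subst h
    simpa using hW.law_diag i
  · simpa [h.ne] using hW.law_upper i j h

/-- Characteristic functions are compared: almost sure symmetry folds the pairing onto the
independent upper entries, where each off-diagonal entry carries `B i j + B j i`. -/
theorem IsGOE.map_eq_goe {Ω : Type*} [MeasurableSpace Ω] {P : Measure Ω} [IsProbabilityMeasure P]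
    {n : ℕ} {W : Ω → Matrix (Fin n) (Fin n) ℝ} (hW : IsGOE P n W) :
    P.map (fun ω i j => W ω i j) = goe (1 / n) n := by
  have hmeas : AEMeasurable (fun ω i j => W ω i j) P :=
    aemeasurable_pi_lambda _ fun i => aemeasurable_pi_lambda _ fun j => hW.aemeasurable i j
  have : IsProbabilityMeasure (P.map (fun ω i j => W ω i j)) :=
    Measure.isProbabilityMeasure_map hmeas
  refine ext_of_integral_cexp_pairing fun B => ?_
  have hm : Measurable fun W : Fin n → Fin n → ℝ =>
      Complex.exp (((∑ i, ∑ j, B i j * W i j : ℝ) : ℂ) * Complex.I) := by fun_prop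
  rw [integral_map hmeas hm.aestronglyMeasurable, integral_cexp_goe]
  set C : {p : Fin n × Fin n // p.1 ≤ p.2} → ℝ := fun p =>
    if p.1.1 = p.1.2 then B p.1.1 p.1.1 else B p.1.1 p.1.2 + B p.1.2 p.1.1 with hC
  have hsum : ∀ᵐ ω ∂P, Complex.exp (((∑ i, ∑ j, B i j * W ω i j : ℝ) : ℂ) * Complex.I) =
      ∏ p : {p : Fin n × Fin n // p.1 ≤ p.2},
        Complex.exp (((C p * W ω p.1.1 p.1.2 : ℝ) : ℂ) * Complex.I) := by
    filter_upwards [hW.symm] with ω hω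
    rw [← Complex.exp_sum, ← Finset.sum_mul, ← Complex.ofReal_sum, sum_sum_eq_sum_upper]
    congr 3
    refine Finset.sum_congr rfl fun p _ => ?_
    simp only [hC]
    split_ifs with h
    · rw [← h]
    · rw [hω.apply p.1.1 p.1.2]; ring
  rw [integral_congr_ae hsum, hW.indep.integral_fun_prod_comp
    (f := fun p x => Complex.exp (((C p * x : ℝ) : ℂ) * Complex.I))
    (fun p => hW.aemeasurable _ _) (fun p => by
      have : Measurable fun x : ℝ => Complex.exp (((C p * x : ℝ) : ℂ) * Complex.I) := by fun_prop
      exact this.aestronglyMeasurable)]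
  have hfac : ∀ p : {p : Fin n × Fin n // p.1 ≤ p.2},
      ∫ ω, Complex.exp (((C p * W ω p.1.1 p.1.2 : ℝ) : ℂ) * Complex.I) ∂P =
      Complex.exp ((-(((if p.1.1 = p.1.2 then 2 / n else 1 / n : NNReal) : ℝ) * C p ^ 2 / 2) : ℝ)
        : ℂ) := by
    intro p
    have hmp : Measurable fun x : ℝ => Complex.exp (((C p * x : ℝ) : ℂ) * Complex.I) := by
      fun_prop
    rw [← integral_cexp_gaussianReal]
    exact (hW.law_of_le p).integral_comp hmp.aestronglyMeasurable
  simp_rw [hfac]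
  rw [← Complex.exp_sum, ← Complex.ofReal_sum]
  congr 2
  rw [sum_sum_eq_sum_upper, Finset.mul_sum, ← Finset.sum_neg_distrib]
  refine Finset.sum_congr rfl fun p _ => ?_
  simp only [hC]
  split_ifs with h
  · push_cast; ring
  · push_cast; ring

/-! ### Tridiagonal reduction for the largest eigenvalue. -/

/-- The arrays for which the quadratic form, with an additional rank-one term `c (e · x)²`,
exceeds `t ‖x‖²` at some point. -/
def exceedance {n : ℕ} (e : Fin n → ℝ) (c t : ℝ) : Set (Fin n → Fin n → ℝ) :=
  {W | ∃ x : Fin n → ℝ, t * ∑ i, x i ^ 2 < quadForm W x + c * (∑ i, e i * x i) ^ 2}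

theorem mem_exceedance {n : ℕ} {e : Fin n → ℝ} {c t : ℝ} {W : Fin n → Fin n → ℝ} :
    W ∈ exceedance e c t ↔
      ∃ x : Fin n → ℝ, t * ∑ i, x i ^ 2 < quadForm W x + c * (∑ i, e i * x i) ^ 2 :=
  Iff.rfl

/-- The strict inequality is open in `x`, so a dense sequence of test vectors suffices. Joint
measurability is needed because the direction and coefficient become random, functions of the
removed row. -/
theorem measurableSet_mem_exceedance {n : ℕ} {e : (Fin n → ℝ) → Fin n → ℝ}
    {c : (Fin n → ℝ) → ℝ} (he : Measurable e) (hc : Measurable c) (t : ℝ) :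
    MeasurableSet {p : (Fin n → ℝ) × (Fin n → Fin n → ℝ) |
      p.2 ∈ exceedance (e p.1) (c p.1) t} := by
  have h : {p : (Fin n → ℝ) × (Fin n → Fin n → ℝ) | p.2 ∈ exceedance (e p.1) (c p.1) t} =
      ⋃ m : ℕ, {p | t * ∑ i, TopologicalSpace.denseSeq (Fin n → ℝ) m i ^ 2 <
        quadForm p.2 (TopologicalSpace.denseSeq (Fin n → ℝ) m) +
          c p.1 * (∑ i, e p.1 i * TopologicalSpace.denseSeq (Fin n → ℝ) m i) ^ 2} := by
    ext p
    simp only [Set.mem_ofPred_eq, Set.mem_iUnion, mem_exceedance]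
    constructor
    · intro hx
      have ho : IsOpen {x : Fin n → ℝ | t * ∑ i, x i ^ 2 <
          quadForm p.2 x + c p.1 * (∑ i, e p.1 i * x i) ^ 2} := by
        unfold quadForm
        exact isOpen_lt (by fun_prop) (by fun_prop)
      exact (TopologicalSpace.denseRange_denseSeq (Fin n → ℝ)).exists_mem_open ho hx
    · rintro ⟨m, hm⟩
      exact ⟨_, hm⟩
  rw [h]
  refine MeasurableSet.iUnion fun m => measurableSet_lt measurable_const ?_
  unfold quadForm
  have h1 : ∀ i, Measurable fun p : (Fin n → ℝ) × (Fin n → Fin n → ℝ) => e p.1 i := fun i =>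
    (measurable_pi_apply i).comp (he.comp measurable_fst)
  have h2 : Measurable fun p : (Fin n → ℝ) × (Fin n → Fin n → ℝ) => c p.1 :=
    hc.comp measurable_fst
  fun_prop

theorem measurableSet_exceedance {n : ℕ} (e : Fin n → ℝ) (c t : ℝ) :
    MeasurableSet (exceedance e c t) :=
  (measurable_const.prodMk measurable_id : Measurable fun W : Fin n → Fin n → ℝ =>
    ((0 : Fin n → ℝ), W)) (measurableSet_mem_exceedance (e := fun _ => e) (c := fun _ => c)
      measurable_const measurable_const t)

/-- A symmetric orthogonal matrix (a Householder reflection) exchanging two unit vectors. -/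
theorem exists_reflection {n : ℕ} (e f : Fin n → ℝ) (he : e ⬝ᵥ e = 1) (hf : f ⬝ᵥ f = 1) :
    ∃ H : Matrix (Fin n) (Fin n) ℝ, Hᵀ = H ∧ H * H = 1 ∧ H *ᵥ e = f := by
  rcases eq_or_ne e f with rfl | hne
  · exact ⟨1, by simp, by simp, by simp⟩
  set w := e - f with hw
  have hww : w ⬝ᵥ w ≠ 0 := by
    rw [Ne, dotProduct_self_eq_zero]
    exact sub_ne_zero.2 hne
  have hwe : w ⬝ᵥ e = w ⬝ᵥ w / 2 := by
    have hfe : f ⬝ᵥ e = e ⬝ᵥ f := dotProduct_comm _ _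
    rw [hw, sub_dotProduct, sub_dotProduct, dotProduct_sub, dotProduct_sub, he, hf, hfe]
    ring
  have hsq : vecMulVec w w * vecMulVec w w = (w ⬝ᵥ w) • vecMulVec w w := by
    rw [vecMulVec_mul_vecMulVec, vecMulVec_smul]
  refine ⟨1 - (2 / (w ⬝ᵥ w)) • vecMulVec w w, ?_, ?_, ?_⟩
  · rw [transpose_sub, transpose_one, transpose_smul, transpose_vecMulVec]
  · rw [sub_mul, mul_sub, mul_sub, Matrix.one_mul, Matrix.one_mul, Matrix.mul_one,
      smul_mul_smul_comm, hsq, smul_smul]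
    have : 2 / (w ⬝ᵥ w) * (2 / (w ⬝ᵥ w)) * (w ⬝ᵥ w) = 2 * (2 / (w ⬝ᵥ w)) := by
      field_simp
    rw [this, mul_smul, two_smul]
    abel
  · rw [sub_mulVec, one_mulVec, smul_mulVec, vecMulVec_mulVec, hwe]
    have : (2 / (w ⬝ᵥ w)) * (w ⬝ᵥ w / 2) = 1 := by field_simp
    ext i
    simp only [Pi.sub_apply, Pi.smul_apply, smul_eq_mul, MulOpposite.smul_eq_mul_unop,
      MulOpposite.unop_op]
    have h2 : (2 / (w ⬝ᵥ w)) * (w i * (w ⬝ᵥ w / 2)) = w i := by field_simp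
    rw [h2, hw]
    simp

theorem quadForm_conj {n : ℕ} (H W : Matrix (Fin n) (Fin n) ℝ) (x : Fin n → ℝ) :
    quadForm (fun i j => (Hᵀ * (W * H)) i j) x = quadForm W (H *ᵥ x) := by
  have h1 := quadForm_eq_sum_mulVec (Hᵀ * (W * H)) x
  have h2 := quadForm_eq_sum_mulVec W (H *ᵥ x)
  change quadForm (fun i j => (Hᵀ * (W * H)) i j) x = x ⬝ᵥ ((Hᵀ * (W * H)) *ᵥ x) at h1
  change quadForm W (H *ᵥ x) = (H *ᵥ x) ⬝ᵥ (W *ᵥ (H *ᵥ x)) at h2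
  rw [h1, h2, ← mulVec_mulVec, ← mulVec_mulVec, dotProduct_mulVec, vecMul_transpose]

/-- By orthogonal invariance, the probability of an exceedance does not depend on the direction
of the rank-one term. -/
theorem goe_exceedance_eq (v : NNReal) {n : ℕ} {e f : Fin n → ℝ} (he : e ⬝ᵥ e = 1)
    (hf : f ⬝ᵥ f = 1) (c t : ℝ) :
    goe v n (exceedance e c t) = goe v n (exceedance f c t) := by
  obtain ⟨H, hHt, hHH, hHe⟩ := exists_reflection e f he hf
  have hmeas : Measurable
      (fun W : Fin n → Fin n → ℝ => (fun i j => (Hᵀ * (Matrix.of W * H)) i j)) := by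
    refine measurable_pi_lambda _ fun i => measurable_pi_lambda _ fun j => ?_
    simp only [mul_apply, of_apply]
    fun_prop
  have hpre : (fun W : Fin n → Fin n → ℝ => (fun i j => (Hᵀ * (Matrix.of W * H)) i j)) ⁻¹'
      exceedance f c t = exceedance e c t := by
    have hfx : ∀ x, ∑ i, f i * x i = ∑ i, e i * (H *ᵥ x) i := by
      intro x
      change f ⬝ᵥ x = e ⬝ᵥ (H *ᵥ x)
      rw [dotProduct_mulVec, ← hHe, ← mulVec_transpose, hHt]
    have hnorm : ∀ x, ∑ i, x i ^ 2 = ∑ i, (H *ᵥ x) i ^ 2 := by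
      intro x
      have : x ⬝ᵥ x = (H *ᵥ x) ⬝ᵥ (H *ᵥ x) := by
        rw [dotProduct_mulVec, ← mulVec_transpose, hHt, mulVec_mulVec, hHH, one_mulVec]
      simpa [dotProduct, sq] using this
    ext W
    simp only [Set.mem_preimage, mem_exceedance, quadForm_conj, hfx]
    constructor
    · rintro ⟨x, hx⟩
      rw [hnorm] at hx
      exact ⟨H *ᵥ x, hx⟩
    · rintro ⟨x, hx⟩
      refine ⟨H *ᵥ x, ?_⟩
      rw [mulVec_mulVec, hHH, one_mulVec, ← hnorm]
      exact hx
  have hHtH : Hᵀ * H = 1 := by rw [hHt, hHH]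
  conv_rhs => rw [← map_conj_goe v hHtH]
  rw [Measure.map_apply hmeas (measurableSet_exceedance f c t), hpre]

theorem quadForm_borderedArray {n : ℕ} (a : ℝ) (b : Fin n → ℝ) (W : Fin n → Fin n → ℝ)
    (x : Fin (n + 1) → ℝ) :
    quadForm (borderedArray a b W) x =
      a * x 0 ^ 2 + 2 * x 0 * (∑ i, b i * x i.succ) + quadForm W fun i => x i.succ := by
  simp only [quadForm, borderedArray, Fin.sum_univ_succ, Fin.cons_zero, Fin.cons_succ,
    Finset.sum_add_distrib, Finset.mul_sum]
  have h : ∑ i : Fin n, b i * (x 0 * x i.succ) + ∑ i : Fin n, b i * (x i.succ * x 0) =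
      ∑ i : Fin n, 2 * x 0 * (b i * x i.succ) := by
    rw [← Finset.sum_add_distrib]
    exact Finset.sum_congr rfl fun i _ => by ring
  linear_combination h

/-- One step of the tridiagonal reduction: an exceedance in dimension `n + 1` forces a large
corner entry or an exceedance of the remaining block in the direction of the first row. -/
theorem borderedArray_notMem_exceedance {n : ℕ} {a c t : ℝ} {b : Fin n → ℝ}
    {W : Fin n → Fin n → ℝ} (ha : a + c + √(∑ i, b i ^ 2) ≤ t)
    (hW : W ∉ exceedance (fun i => b i / √(∑ i, b i ^ 2)) (√(∑ i, b i ^ 2)) t) :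
    borderedArray a b W ∉ exceedance (Pi.single 0 1) c t := by
  rw [mem_exceedance] at hW ⊢
  push Not at hW ⊢
  intro x
  have h1 := hW fun i => x i.succ
  set s := √(∑ i, b i ^ 2) with hs
  have hs0 : 0 ≤ s := Real.sqrt_nonneg _
  have hdot : ∑ i, (Pi.single 0 1 : Fin (n + 1) → ℝ) i * x i = x 0 := by
    simp [Pi.single_apply]
  rw [quadForm_borderedArray, hdot, Fin.sum_univ_succ]
  set d := ∑ i, b i / s * x i.succ with hd
  have hbd : ∑ i, b i * x i.succ = s * d := by
    -- When `s = 0` the normalized row is zero by the convention for division, and both sides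
    -- vanish.
    rcases eq_or_lt_of_le hs0 with h | h
    · have hb : ∀ i, b i = 0 := by
        have h0 : ∑ i, b i ^ 2 = 0 :=
          (Real.sqrt_eq_zero (Finset.sum_nonneg fun i _ => sq_nonneg _)).1 h.symm
        intro i
        simpa using (Finset.sum_eq_zero_iff_of_nonneg fun i _ => sq_nonneg (b i)).1 h0 i
          (Finset.mem_univ i)
      simp [hb, ← h]
    · rw [hd, Finset.mul_sum]
      exact Finset.sum_congr rfl fun i _ => by field_simp
  rw [hbd]
  -- The coupling with the removed row splits into a correction `s` of the corner and a rank-one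
  -- term `s d²` on the block: the shape of the next exceedance.
  have h2 : 2 * x 0 * (s * d) ≤ s * x 0 ^ 2 + s * d ^ 2 := by
    nlinarith [mul_nonneg hs0 (sq_nonneg (x 0 - d))]
  have h3 := mul_le_mul_of_nonneg_right ha (sq_nonneg (x 0))
  linarith

theorem exceedance_zero_subset {n : ℕ} (e : Fin n → ℝ) {c : ℝ} (hc : 0 ≤ c) (t : ℝ) :
    exceedance 0 c t ⊆ exceedance e c t := by
  rintro W ⟨x, hx⟩
  refine ⟨x, hx.trans_le ?_⟩
  have : 0 ≤ c * (∑ i, e i * x i) ^ 2 := by positivity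
  simpa using this

theorem exceedance_fin_zero (e : Fin 0 → ℝ) (c t : ℝ) : exceedance e c t = ∅ := by
  ext W
  simp [mem_exceedance, quadForm]

theorem normalized_dotProduct_self {n : ℕ} (b : Fin n → ℝ) :
    (fun i => b i / √(∑ i, b i ^ 2)) ⬝ᵥ (fun i => b i / √(∑ i, b i ^ 2)) = 1 ∨
      (fun i => b i / √(∑ i, b i ^ 2)) = 0 := by
  have hnn : 0 ≤ ∑ i, b i ^ 2 := Finset.sum_nonneg fun i _ => sq_nonneg _
  rcases eq_or_lt_of_le hnn with h | h
  · right
    rw [← h]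
    ext i
    simp
  · left
    simp only [dotProduct, ← sq, div_pow, Real.sq_sqrt hnn]
    rw [← Finset.sum_div, div_self h.ne']

/-- Bound on the exceedance probability by the tridiagonal reduction. -/
theorem goe_exceedance_le (v : NNReal) {N : ℕ} {r t : ℝ} {η : ENNReal} (hr : 0 ≤ r)
    (hη : ∀ j < N, gaussianReal 0 (2 * v) {a | t - 2 * r < a} +
      Measure.pi (fun _ : Fin j => gaussianReal 0 v) {b | r ^ 2 < ∑ i, b i ^ 2} ≤ η)
    {n : ℕ} (hn : n ≤ N) {e : Fin n → ℝ} {c : ℝ} (he : e ⬝ᵥ e = 1 ∨ e = 0) (hc : 0 ≤ c)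
    (hcr : c ≤ r) : goe v n (exceedance e c t) ≤ n * η := by
  -- The variance `v` and the failure bound `η` stay fixed while the dimension drops; `c` varies
  -- because the next coefficient is the norm of the removed row.
  induction n generalizing c with
  | zero => simp [exceedance_fin_zero]
  | succ n ih =>
    have hstd : (Pi.single 0 1 : Fin (n + 1) → ℝ) ⬝ᵥ Pi.single 0 1 = 1 := by simp
    have hred : goe v (n + 1) (exceedance e c t) ≤
        goe v (n + 1) (exceedance (Pi.single 0 1) c t) := by
      rcases he with he | rfl
      · rw [goe_exceedance_eq v he hstd]
      · exact measure_mono (exceedance_zero_subset _ hc t)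
    refine hred.trans ?_
    rw [goe, Measure.map_apply measurable_borderedArray (measurableSet_exceedance _ _ _)]
    set S : Set ((Fin n → ℝ) × (Fin n → Fin n → ℝ)) :=
      {q | q.1 ∈ {b : Fin n → ℝ | ∑ i, b i ^ 2 ≤ r ^ 2} ∧ q.2 ∈
        exceedance (fun i => q.1 i / √(∑ i, q.1 i ^ 2)) (√(∑ i, q.1 i ^ 2)) t} with hS
    have hSm : MeasurableSet S := by
      refine MeasurableSet.inter ?_ ?_
      · exact measurableSet_le (by fun_prop) measurable_const
      · exact measurableSet_mem_exceedance
          (e := fun b i => b i / √(∑ i, b i ^ 2)) (c := fun b => √(∑ i, b i ^ 2))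
          (by fun_prop) (by fun_prop) t
    have hsub : (fun p : ℝ × (Fin n → ℝ) × (Fin n → Fin n → ℝ) =>
        borderedArray p.1 p.2.1 p.2.2) ⁻¹' exceedance (Pi.single 0 1) c t ⊆
        ({a | t - 2 * r < a} ×ˢ Set.univ) ∪
        ((Set.univ ×ˢ ({b | r ^ 2 < ∑ i, b i ^ 2} ×ˢ Set.univ)) ∪ (Set.univ ×ˢ S)) := by
      rintro ⟨a, b, W⟩ hp
      by_contra hcon
      simp only [Set.mem_union, Set.mem_prod, Set.mem_ofPred_eq, Set.mem_univ, and_true, true_and,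
        not_or, not_lt, hS, not_and] at hcon
      obtain ⟨h1, h2, h3⟩ := hcon
      refine borderedArray_notMem_exceedance ?_ (h3 h2) hp
      have : √(∑ i, b i ^ 2) ≤ r := Real.sqrt_le_iff.2 ⟨hr, h2⟩
      linarith
    refine (measure_mono hsub).trans ?_
    refine (measure_union_le _ _).trans ?_
    refine (add_le_add le_rfl (measure_union_le _ _)).trans ?_
    rw [Measure.prod_prod, Measure.prod_prod, Measure.prod_prod, Measure.prod_prod]
    simp only [measure_univ, mul_one, one_mul]
    rw [← add_assoc, Nat.cast_succ, add_mul, one_mul, add_comm]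
    refine add_le_add ?_ (hη n hn)
    rw [Measure.prod_apply hSm]
    -- Fubini: with the row `b` fixed, the independent block still has law `goe v n`, so the
    -- induction hypothesis applies to the direction of `b`.
    have hle : ∀ b : Fin n → ℝ, goe v n (Prod.mk b ⁻¹' S) ≤ n * η := by
      intro b
      by_cases hb : ∑ i, b i ^ 2 ≤ r ^ 2
      · refine (measure_mono ?_).trans (ih (by omega) (normalized_dotProduct_self b)
          (Real.sqrt_nonneg _) (Real.sqrt_le_iff.2 ⟨hr, hb⟩))
        rintro W ⟨-, hW⟩
        exact hW
      · have : Prod.mk b ⁻¹' S = ∅ := by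
          ext W
          simp [hS, hb]
        rw [this, measure_empty]
        exact zero_le
    refine (lintegral_mono hle).trans ?_
    rw [lintegral_const, measure_univ, mul_one]

/-! ### Chernoff bounds and the exponential tail. -/

theorem gaussianReal_gt_le (v : NNReal) {δ : ℝ} (hδ : 0 ≤ δ) (hv : 0 < v) :
    gaussianReal 0 (2 * v) {a | δ < a} ≤ ENNReal.ofReal (Real.exp (-(δ ^ 2 / (4 * v)))) := by
  have hv' : (0 : ℝ) < v := hv
  have h := measure_ge_le_exp_mul_mgf (X := id) (μ := gaussianReal 0 (2 * v))
    (t := δ / (2 * v)) δ (by positivity) (integrable_exp_mul_gaussianReal _)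
  rw [mgf_id_gaussianReal, ← Real.exp_add] at h
  have he : -(δ / (2 * v)) * δ + (0 * (δ / (2 * v)) + (2 * v : NNReal) * (δ / (2 * v)) ^ 2 / 2) =
      -(δ ^ 2 / (4 * v)) := by
    push_cast
    field_simp
    ring
  rw [he] at h
  rw [← ofReal_measureReal]
  refine ENNReal.ofReal_le_ofReal (le_trans (measureReal_mono ?_) h)
  intro a ha
  rw [Set.mem_ofPred_eq] at ha ⊢
  exact le_of_lt ha

theorem integral_exp_sq_gaussianReal {v : NNReal} (hv : 0 < v) {s : ℝ} (hs : s < 1 / 2) :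
    ∫ x, Real.exp (s / v * x ^ 2) ∂gaussianReal 0 v = (√(1 - 2 * s))⁻¹ := by
  have hv' : (0 : ℝ) < v := hv
  have h1 : 0 < 1 - 2 * s := by linarith
  rw [integral_gaussianReal_eq_integral_smul hv.ne']
  have h : ∀ x : ℝ, gaussianPDFReal 0 v x • Real.exp (s / v * x ^ 2) =
      (√(2 * Real.pi * v))⁻¹ * Real.exp (-((1 - 2 * s) / (2 * v)) * x ^ 2) := by
    intro x
    rw [gaussianPDFReal_def, smul_eq_mul, mul_assoc, ← Real.exp_add]
    congr 2
    field_simp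
    ring
  simp_rw [h]
  rw [integral_const_mul, integral_gaussian, ← Real.sqrt_inv, ← Real.sqrt_inv,
    ← Real.sqrt_mul (by positivity)]
  congr 1
  field_simp

theorem pi_gaussianReal_sum_sq_gt_le {v : NNReal} (hv : 0 < v) {s : ℝ} (hs0 : 0 ≤ s)
    (hs : s < 1 / 2) (j : ℕ) (R : ℝ) :
    Measure.pi (fun _ : Fin j => gaussianReal 0 v) {b | R < ∑ i, b i ^ 2} ≤
      ENNReal.ofReal (Real.exp (-(s / v * R)) * (√(1 - 2 * s))⁻¹ ^ j) := by
  have h1 : 0 < 1 - 2 * s := by linarith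
  have hint : Integrable (fun x => Real.exp (s / v * x ^ 2)) (gaussianReal 0 v) := by
    -- A non-integrable function has Bochner integral `0`, so the nonzero value computed above
    -- proves integrability.
    refine Integrable.of_integral_ne_zero ?_
    rw [integral_exp_sq_gaussianReal hv hs]
    exact (inv_pos.2 (Real.sqrt_pos.2 h1)).ne'
  have hprod : ∀ b : Fin j → ℝ, Real.exp (s / v * ∑ i, b i ^ 2) =
      ∏ i, Real.exp (s / v * b i ^ 2) := fun b => by
    rw [Finset.mul_sum, Real.exp_sum]
  have h := measure_ge_le_exp_mul_mgf (X := fun b : Fin j → ℝ => ∑ i, b i ^ 2)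
    (μ := Measure.pi (fun _ : Fin j => gaussianReal 0 v)) (t := s / v) R (by positivity) (by
      simp_rw [hprod]
      exact Integrable.fintype_prod (f := fun _ x => Real.exp (s / v * x ^ 2)) fun _ => hint)
  rw [mgf] at h
  simp_rw [hprod] at h
  rw [integral_fintype_prod_eq_prod (f := fun _ x => Real.exp (s / v * x ^ 2))] at h
  simp only [integral_exp_sq_gaussianReal hv hs, Finset.prod_const, Finset.card_univ,
    Fintype.card_fin] at h
  rw [← ofReal_measureReal]
  refine ENNReal.ofReal_le_ofReal (le_trans (measureReal_mono ?_) (h.trans (le_of_eq ?_)))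
  · intro b hb
    rw [Set.mem_ofPred_eq] at hb ⊢
    exact le_of_lt hb
  · rw [neg_mul]

/-- With `s = ε / (4 (1 + ε))` the claim reduces to `(1 - 2s)⁻¹ < 1 + ε/2 ≤ exp (ε/2)`, and the
first inequality is `1 + ε < (1 + ε/2)²`. -/
theorem exists_chiSquare_rate {ε : ℝ} (hε : 0 < ε) :
    ∃ s, 0 ≤ s ∧ s < 1 / 2 ∧ Real.exp (-(s * (1 + ε))) * (√(1 - 2 * s))⁻¹ < 1 := by
  obtain ⟨s, hs⟩ : ∃ s, s = ε / (4 * (1 + ε)) := ⟨_, rfl⟩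
  have hs' : s * (1 + ε) = ε / 4 := by
    rw [hs]; field_simp
  have hs0 : 0 < s := by rw [hs]; positivity
  have hs1 : s < 1 / 2 := by nlinarith
  refine ⟨s, hs0.le, hs1, ?_⟩
  have h1 : 0 < 1 - 2 * s := by linarith
  rw [← div_eq_mul_inv, div_lt_one (Real.sqrt_pos.2 h1)]
  refine Real.lt_sqrt_of_sq_lt ?_
  rw [← Real.exp_nat_mul, hs']
  have h2 : 1 + ε / 2 ≤ Real.exp (ε / 2) := by linarith [Real.add_one_le_exp (ε / 2)]
  have h3 : Real.exp ((2 : ℕ) * -(ε / 4)) = (Real.exp (ε / 2))⁻¹ := by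
    rw [← Real.exp_neg]
    congr 1
    push_cast
    ring
  rw [h3]
  refine inv_lt_of_inv_lt₀ h1 (lt_of_lt_of_le ?_ h2)
  rw [inv_lt_iff_one_lt_mul₀ h1]
  nlinarith

/-- The largest eigenvalue of the normalized ensemble exceeds `2 + κ` with exponentially small
probability. -/
theorem exists_goe_exceedance_le {κ : ℝ} (hκ : 0 < κ) :
    ∃ ρ : ℝ, 0 ≤ ρ ∧ ρ < 1 ∧ ∀ n : ℕ,
      goe (1 / n) n (exceedance 0 0 (2 + κ)) ≤ ENNReal.ofReal (2 * (n * ρ ^ n)) := by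
  obtain ⟨s, hs0, hs1, hs⟩ := exists_chiSquare_rate (show 0 < κ / 2 by positivity)
  set q := Real.exp (-(s * (1 + κ / 2))) * (√(1 - 2 * s))⁻¹ with hq
  have h1 : 0 < 1 - 2 * s := by linarith
  have hsq : 1 ≤ (√(1 - 2 * s))⁻¹ := by
    rw [one_le_inv₀ (Real.sqrt_pos.2 h1)]
    exact Real.sqrt_le_one.2 (by linarith)
  have hq0 : 0 ≤ q := by positivity
  refine ⟨max q (Real.exp (-((κ / 2) ^ 2 / 4))), le_max_of_le_left hq0,
    max_lt hs (Real.exp_lt_one_iff.2 (by rw [neg_lt_zero]; positivity)), fun n => ?_⟩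
  rcases Nat.eq_zero_or_pos n with rfl | hn
  · simp [exceedance_fin_zero]
  have hn' : (0 : ℝ) < n := by exact_mod_cast hn
  have hv : (0 : NNReal) < 1 / n := by
    have : (0 : NNReal) < n := by exact_mod_cast hn
    positivity
  have hvr : ((1 / n : NNReal) : ℝ) = 1 / n := by push_cast; rfl
  set ρ := max q (Real.exp (-((κ / 2) ^ 2 / 4))) with hρ
  have hρ0 : 0 ≤ ρ := le_max_of_le_left hq0
  -- Row norms concentrate below `1`; the margin `κ / 4` on each of the two norms in `2 * r` leaves
  -- `κ / 2` for the corner entry.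
  have h := goe_exceedance_le (1 / n) (N := n) (r := 1 + κ / 4) (t := 2 + κ)
    (η := ENNReal.ofReal (2 * ρ ^ n)) (by positivity) (fun j hj => ?_) le_rfl
    (e := 0) (c := 0) (Or.inr rfl) le_rfl (by positivity)
  · refine h.trans (le_of_eq ?_)
    rw [← ENNReal.ofReal_natCast, ← ENNReal.ofReal_mul hn'.le]
    congr 1
    ring
  · have ha : gaussianReal 0 (2 * (1 / n)) {a | 2 + κ - 2 * (1 + κ / 4) < a} ≤
        ENNReal.ofReal (ρ ^ n) := by
      refine (gaussianReal_gt_le (1 / n) (by linarith) hv).trans (ENNReal.ofReal_le_ofReal ?_)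
      refine le_trans (le_of_eq ?_) (pow_le_pow_left₀ (Real.exp_pos _).le (le_max_right q _) n)
      rw [← Real.exp_nat_mul, hvr]
      congr 1
      field_simp
      ring
    have hb : Measure.pi (fun _ : Fin j => gaussianReal 0 (1 / n))
        {b | (1 + κ / 4) ^ 2 < ∑ i, b i ^ 2} ≤ ENNReal.ofReal (ρ ^ n) := by
      refine (pi_gaussianReal_sum_sq_gt_le hv hs0 hs1 j _).trans (ENNReal.ofReal_le_ofReal ?_)
      refine le_trans ?_ (pow_le_pow_left₀ hq0 (le_max_left q _) n)
      rw [hq, mul_pow, ← Real.exp_nat_mul, hvr]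
      -- Each factor is at least `1`, so a shorter row may be padded to length `n`; also `(1 + κ/4)²
      -- ≥ 1 + κ/2`.
      refine mul_le_mul ?_ (pow_le_pow_right₀ hsq hj.le) (by positivity) (Real.exp_pos _).le
      refine Real.exp_le_exp.2 ?_
      have : s / (1 / n) = n * s := by field_simp
      rw [this]
      nlinarith [mul_nonneg (mul_nonneg hn'.le hs0) (sq_nonneg κ)]
    calc _ ≤ ENNReal.ofReal (ρ ^ n) + ENNReal.ofReal (ρ ^ n) := add_le_add ha hb
      _ = ENNReal.ofReal (2 * ρ ^ n) := by
        rw [← ENNReal.ofReal_add (by positivity) (by positivity)]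
        congr 1
        ring

/-! ### Almost sure noise bound and conclusion. -/

theorem IsGOE.neg {Ω : Type*} [MeasurableSpace Ω] {P : Measure Ω} {n : ℕ}
    {W : Ω → Matrix (Fin n) (Fin n) ℝ} (hW : IsGOE P n W) : IsGOE P n fun ω => -W ω := by
  have hneg : ∀ (v : NNReal) (i j : Fin n), HasLaw (fun ω => W ω i j) (gaussianReal 0 v) P →
      HasLaw (fun ω => (-W ω) i j) (gaussianReal 0 v) P := by
    intro v i j h
    refine ⟨h.aemeasurable.neg, ?_⟩
    have e : (fun ω => (-W ω) i j) = (fun x : ℝ => -x) ∘ fun ω => W ω i j := rfl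
    rw [e, ← AEMeasurable.map_map_of_aemeasurable measurable_neg.aemeasurable h.aemeasurable,
      h.map_eq, gaussianReal_map_neg, neg_zero]
  refine ⟨?_, ?_, fun i => hneg _ _ _ (hW.law_diag i), fun i j hij =>
    hneg _ _ _ (hW.law_upper i j hij)⟩
  · filter_upwards [hW.symm] with ω hω
    exact hω.neg
  · exact hW.indep.comp (fun _ x => -x) fun _ => measurable_neg

theorem ae_eventually_quadForm_le {Ω : Type*} [MeasurableSpace Ω] {P : Measure Ω}
    [IsProbabilityMeasure P] {W : ∀ n : ℕ, Ω → Matrix (Fin n) (Fin n) ℝ}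
    (hW : ∀ n, IsGOE P n (W n)) {κ : ℝ} (hκ : 0 < κ) :
    ∀ᵐ ω ∂P, ∀ᶠ n in atTop, ∀ x, quadForm (W n ω) x ≤ (2 + κ) * ∑ i, x i ^ 2 := by
  obtain ⟨ρ, hρ0, hρ1, hρ⟩ := exists_goe_exceedance_le hκ
  have hP : ∀ n, P {ω | (fun i j => W n ω i j) ∈ exceedance 0 0 (2 + κ)} ≤
      ENNReal.ofReal (2 * (n * ρ ^ n)) := by
    intro n
    have hmeas : AEMeasurable (fun ω i j => W n ω i j) P :=
      aemeasurable_pi_lambda _ fun i => aemeasurable_pi_lambda _ fun j => (hW n).aemeasurable i j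
    refine le_trans (le_of_eq ?_) (hρ n)
    rw [← (hW n).map_eq_goe, Measure.map_apply_of_aemeasurable hmeas
      (measurableSet_exceedance _ _ _)]
    rfl
  have hsum : Summable fun n : ℕ => 2 * ((n : ℝ) * ρ ^ n) := by
    have := summable_pow_mul_geometric_of_norm_lt_one (R := ℝ) 1 (r := ρ)
      (by rwa [Real.norm_eq_abs, abs_of_nonneg hρ0])
    simpa using this.mul_left 2
  have hne : ∑' n, P {ω | (fun i j => W n ω i j) ∈ exceedance 0 0 (2 + κ)} ≠ ⊤ :=
    ne_top_of_le_ne_top hsum.tsum_ofReal_ne_top (ENNReal.tsum_le_tsum hP)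
  filter_upwards [ae_eventually_notMem hne] with ω hω
  filter_upwards [hω] with n hn x
  by_contra! hx
  exact hn ⟨x, by simpa using hx⟩

theorem quadForm_neg {n : ℕ} (W : Matrix (Fin n) (Fin n) ℝ) (x : Fin n → ℝ) :
    quadForm (-W) x = -quadForm W x := by
  simp only [quadForm, Matrix.neg_apply, neg_mul, Finset.sum_neg_distrib]

theorem ae_eventually_abs_quadForm_le {Ω : Type*} [MeasurableSpace Ω] {P : Measure Ω}
    [IsProbabilityMeasure P] {W : ∀ n : ℕ, Ω → Matrix (Fin n) (Fin n) ℝ}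
    (hW : ∀ n, IsGOE P n (W n)) {κ : ℝ} (hκ : 0 < κ) :
    ∀ᵐ ω ∂P, ∀ᶠ n in atTop, ∀ x, |quadForm (W n ω) x| ≤ (2 + κ) * ∑ i, x i ^ 2 := by
  filter_upwards [ae_eventually_quadForm_le hW hκ,
    ae_eventually_quadForm_le (fun n => (hW n).neg) hκ] with ω h1 h2
  filter_upwards [h1, h2] with n h3 h4 x
  have := h4 x
  rw [quadForm_neg] at this
  exact abs_le.2 ⟨by linarith, h3 x⟩

theorem theorem5 {Ω : Type*} [MeasurableSpace Ω] (P : Measure Ω) [IsProbabilityMeasure P]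
    (k : ℕ) (hk : 2 ≤ k) (l : ℝ) (hl : 0 < l)
    (u : ∀ n : ℕ, Fin n → ℝ) (hu : ∀ n i, u n i = 1 ∨ u n i = -1)
    (W : ∀ n : ℕ, Ω → Matrix (Fin n) (Fin n) ℝ) (hW : ∀ n, IsGOE P n (W n)) :
    ∀ᵐ ω ∂P,
      ((1 - min (16 / l) (1 / (k : ℝ) + 4 / l) : ℝ) : EReal) ≤
        liminf (fun n : ℕ =>
          ⨅ σ ∈ localMaximizers k (spikedMatrix l (u n) (W n ω)),
            ((correlation (u n) σ : ℝ) : EReal)) atTop := by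
  have hu2 : ∀ n i, u n i ^ 2 = 1 := fun n i => by
    rcases hu n i with h | h <;> rw [h] <;> norm_num
  -- A countable sequence of margins, so that the null sets can be combined; it tends to `0`, and
  -- the factor `1 / 10` keeps `2 + κ m` in the range of `correlation_ge`.
  obtain ⟨κ, hκdef⟩ : ∃ κ : ℕ → ℝ, ∀ m, κ m = 1 / 10 * (1 / ((m : ℝ) + 1)) :=
    ⟨_, fun _ => rfl⟩
  have hκ0 : ∀ m, 0 < κ m := fun m => by rw [hκdef]; positivity
  have hκ1 : ∀ m, κ m ≤ 1 / 10 := fun m => by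
    have : 1 / ((m : ℝ) + 1) ≤ 1 := by
      rw [div_le_one (by positivity)]
      linarith [(Nat.cast_nonneg m : (0 : ℝ) ≤ m)]
    rw [hκdef]
    linarith
  have hκlim : Tendsto κ atTop (nhds 0) := by
    rw [funext hκdef]
    simpa using (tendsto_one_div_add_atTop_nhds_zero_nat (𝕜 := ℝ)).const_mul (1 / 10 : ℝ)
  have hsymm : ∀ᵐ ω ∂P, ∀ n, (W n ω).IsSymm := ae_all_iff.2 fun n => (hW n).symm
  have hnorm : ∀ᵐ ω ∂P, ∀ m, ∀ᶠ n in atTop, ∀ x,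
      |quadForm (W n ω) x| ≤ (2 + κ m) * ∑ i, x i ^ 2 :=
    ae_all_iff.2 fun m => ae_eventually_abs_quadForm_le hW (hκ0 m)
  filter_upwards [hsymm, hnorm] with ω hsym hω
  have hlim : Tendsto
      (fun m => ((1 - min (16 / l) (1 / (k : ℝ) + 2 * (2 + κ m) / l) : ℝ) : EReal)) atTop
      (nhds ((1 - min (16 / l) (1 / (k : ℝ) + 4 / l) : ℝ) : EReal)) := by
    have hc : Continuous fun y : ℝ => 1 - min (16 / l) (1 / (k : ℝ) + 2 * (2 + y) / l) := by
      fun_prop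
    have h0 := (hc.tendsto 0).comp hκlim
    have e : 2 * (2 + (0 : ℝ)) / l = 4 / l := by norm_num
    rw [e] at h0
    exact (continuous_coe_real_ereal.tendsto _).comp h0
  refine le_of_tendsto' hlim fun m => ?_
  refine le_liminf_of_le (by isBoundedDefault) ?_
  filter_upwards [hω m, eventually_gt_atTop 0] with n hn hn0
  refine le_iInf₂ fun σ hσ => EReal.coe_le_coe_iff.2 ?_
  exact correlation_ge hn0 hk hl (by linarith [hκ0 m]) (by linarith [hκ1 m]) (hu2 n) (hsym n) hn hσ
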